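/- Let $\mathbb D_-=\{|z|>1\}\cup\{\infty\}$, and let $\Sigma'$ be the class of univalent maps $\phi:\mathbb D_-\to\mathbb D_-$ with $\phi(\infty)=\infty$ and $\phi'(\infty):=\lim_{z\to\infty}\phi(z)/z$ real and positive, with the topology of uniform convergence on compact subsets of $\{|z|>1\}$ and its Borel $\sigma$-algebra. Let $\mathbb T=\mathbb R/2\pi\mathbb Z$, let $\lambda$ be the uniform probability measure on $\mathbb T$, and for $\phi\in\Sigma'$, $\theta\in\mathbb T$ put $\phi_\theta(z)=e^{i\theta}\phi(e^{-i\theta}z)$. For $n\ge1$ and $f\in\Sigma'$ let $K_nf\in\Sigma'$ be the Koebe transform $(K_nf)(z)=f(z^n)^{1/n}$ (the branch with positive derivative at infinity); for $g=f^{-1}$, defined on $f(\mathbb D_-)$, let likewise $(K_ng)(z)=g(z^n)^{1/n}$ be the continuous branch, defined on $\{z: z^n\in f(\mathbb D_-)\}$, for which $(K_ng)(z)/z$ has a positive limit at infinity. Let $\phi\in\Sigma'$, $\psi=\phi^{-1}$, and let $k\ge2$ be an integer. For a sequence $(\theta_n)_{n\ge0}$ in $\mathbb T$ let $f_0=\phi_{\theta_0}$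 and $f_n=f_{n-1}\circ K_{k^n}\phi_{\theta_n}$. Then $f_n$ converges, uniformly on compact sets, to some $f\in\Sigma'$ (the conformal snowflake of $\phi$, $k$, $(\theta_n)$). Let now $\theta_0,\theta_1,\dots$ be independent random variables uniformly distributed on $\mathbb T$, so that $f$ is a random element of $\Sigma'$ (the random snowflake), let $\mu$ be its distribution, and let $g=f^{-1}$. Then: 1. $\mu$ is invariant under the random transformation $(f,\theta)\mapsto\phi_\theta\circ K_kf$, $\Sigma'\times\mathbb T\to\Sigma'$: this map is measurable and the image of $\mu\otimes\lambda$ under it is $\mu$. 2. If $\theta$ is uniformly distributed on $\mathbb T$ and independent of $f$, then $f(z)$ and $\phi_\theta\big((K_kf)(z)\big)=\phi_\theta\big(f^{1/k}(z^k)\big)$ have the same distribution as random elements of $\Sigma'$, and $g(z)$ and $(K_kg)(\psi_\theta(z))=g^{1/k}(\psi_\theta^k(z))$, where $\psi_\theta(z)=e^{i\theta}\psi(e^{-i\theta}z)$, have the same distribution as random partial maps of $\{|z|>1\}$ (each with its natural domain), for the $\sigma$-algebra generated by the events "$g$ is defined at $z$ and $g(z)\in B$", $|z|>1$, $B\subset\{|z|>1\}$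 Borel. -/

import Mathlib

open Set Filter Topology MeasureTheory ProbabilityTheory

noncomputable section

namespace Snowflake

/-- The finite part `{z ∈ ℂ : |z| > 1}` of the exterior disk `𝔻₋ = {|z| > 1} ∪ {∞}`. The behaviour
at the point `∞` is prescribed by a limit in the definition of `SigmaPrime`. -/
abbrev ExtDisk : Type := {z : ℂ // 1 < ‖z‖}

/-- The filter of neighbourhoods of `∞` in the exterior disk (with `∞` removed). -/
def nearInfty : Filter ExtDisk := comap (fun z : ExtDisk => ‖(z : ℂ)‖) atTop

/-- The class `Σ'` of univalent maps `φ : 𝔻₋ → 𝔻₋` with `φ(∞) = ∞` and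
`φ'(∞) = lim φ(z) / z` real and positive: `φ(z) = b z + …` at infinity with `b > 0`. -/
structure SigmaPrime where
  toMap : C(ExtDisk, ExtDisk)
  injective : Function.Injective toMap
  holomorphic : ∃ F : ℂ → ℂ, DifferentiableOn ℂ F {z | 1 < ‖z‖} ∧
    ∀ z : ExtDisk, F z = toMap z
  at_infty : ∃ b : ℝ, 0 < b ∧
    Tendsto (fun z : ExtDisk => (toMap z : ℂ) / (z : ℂ)) nearInfty (𝓝 (b : ℂ))

theorem SigmaPrime.ext_map {f g : SigmaPrime} (h : ∀ z, f.toMap z = g.toMap z) : f = g := by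
  have : f.toMap = g.toMap := ContinuousMap.ext h
  cases f; cases g; simp_all

/-- The topology of uniform convergence on compact sets. -/
instance : TopologicalSpace SigmaPrime := TopologicalSpace.induced SigmaPrime.toMap inferInstance

instance : MeasurableSpace SigmaPrime := borel SigmaPrime

instance : BorelSpace SigmaPrime := ⟨rfl⟩

/-- The circle of angles `ℝ / 2πℤ`. -/
abbrev Angles : Type := AddCircle (2 * Real.pi)

instance : Fact (0 < 2 * Real.pi) := ⟨Real.two_pi_pos⟩

/-- The uniform distribution on the circle of angles. -/
def uniformAngle : Measure Angles := AddCircle.haarAddCircle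

/-- The rotation `z ↦ e^{iθ} z` of the exterior disk. -/
def rotPt (θ : Angles) (z : ExtDisk) : ExtDisk :=
  ⟨(AddCircle.toCircle θ : ℂ) * z, by simpa [Circle.norm_coe] using z.2⟩

theorem continuous_rotPt (θ : Angles) : Continuous (rotPt θ) := by
  unfold rotPt; fun_prop

theorem rotPt_neg_rotPt (θ : Angles) (z : ExtDisk) : rotPt (-θ) (rotPt θ z) = z := by
  ext; simp [rotPt, AddCircle.toCircle_neg]

theorem tendsto_rotPt (θ : Angles) : Tendsto (rotPt θ) nearInfty nearInfty := by
  unfold nearInfty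
  rw [tendsto_comap_iff]
  refine tendsto_comap.congr fun z => ?_
  simp [rotPt, Circle.norm_coe]

/-- `φ_θ(z) = e^{iθ} φ(e^{-iθ} z)`. -/
def SigmaPrime.rotate (φ : SigmaPrime) (θ : Angles) : SigmaPrime where
  toMap := ⟨fun z => rotPt θ (φ.toMap (rotPt (-θ) z)),
    (continuous_rotPt θ).comp (φ.toMap.continuous.comp (continuous_rotPt (-θ)))⟩
  injective := by
    have h : ∀ θ, Function.Injective (rotPt θ) := fun θ =>
      Function.LeftInverse.injective (rotPt_neg_rotPt θ)
    exact (h θ).comp (φ.injective.comp (h (-θ)))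
  holomorphic := by
    obtain ⟨F, hF, hFφ⟩ := φ.holomorphic
    refine ⟨fun z => (AddCircle.toCircle θ : ℂ) * F ((AddCircle.toCircle (-θ) : ℂ) * z), ?_, ?_⟩
    · refine DifferentiableOn.const_mul (hF.comp (by fun_prop) ?_) _
      intro z hz
      simpa [Circle.norm_coe] using hz
    · intro z
      simp only [ContinuousMap.coe_mk, rotPt]
      rw [← hFφ]
  at_infty := by
    obtain ⟨b, hb, hlim⟩ := φ.at_infty
    refine ⟨b, hb, ?_⟩
    refine (hlim.comp (tendsto_rotPt (-θ))).congr fun z => ?_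
    have h1 : (AddCircle.toCircle θ : ℂ) ≠ 0 := Circle.coe_ne_zero _
    simp only [Function.comp, rotPt, ContinuousMap.coe_mk, AddCircle.toCircle_neg, Circle.coe_inv]
    field_simp

theorem SigmaPrime.tendsto_nearInfty (f : SigmaPrime) :
    Tendsto f.toMap nearInfty nearInfty := by
  obtain ⟨b, hb, hlim⟩ := f.at_infty
  have h1 : Tendsto (fun z : ExtDisk => ‖(z : ℂ)‖) nearInfty atTop := tendsto_comap
  have h2 := hlim.norm.pos_mul_atTop (by simpa using hb.ne') h1
  rw [nearInfty, tendsto_comap_iff]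
  refine h2.congr fun z => ?_
  have : ‖(z : ℂ)‖ ≠ 0 := (one_pos.trans z.2).ne'
  simp only [norm_div, Function.comp]
  field_simp

/-- Composition of maps in `Σ'`. -/
def SigmaPrime.comp (f g : SigmaPrime) : SigmaPrime where
  toMap := f.toMap.comp g.toMap
  injective := f.injective.comp g.injective
  holomorphic := by
    obtain ⟨F, hF, hFf⟩ := f.holomorphic
    obtain ⟨G, hG, hGg⟩ := g.holomorphic
    refine ⟨F ∘ G, hF.comp hG ?_, ?_⟩
    · intro z hz
      have := (g.toMap ⟨z, hz⟩).2
      rw [← hGg ⟨z, hz⟩] at this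
      exact this
    · intro z
      simp only [Function.comp, ContinuousMap.comp_apply]
      rw [hGg, hFf]
  at_infty := by
    obtain ⟨b, hb, hf⟩ := f.at_infty
    obtain ⟨c, hc, hg⟩ := g.at_infty
    refine ⟨b * c, mul_pos hb hc, ?_⟩
    push_cast
    refine ((hf.comp g.tendsto_nearInfty).mul hg).congr fun z => ?_
    have h1 : (g.toMap z : ℂ) ≠ 0 := norm_pos_iff.1 (one_pos.trans (g.toMap z).2)
    have h2 : (z : ℂ) ≠ 0 := norm_pos_iff.1 (one_pos.trans z.2)
    simp only [Function.comp, ContinuousMap.comp_apply]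
    field_simp

/-- The coordinate `w = 1 / z` at infinity: `f(z) = z G(1/z)` with `G` holomorphic and without
zeros in the unit disk and `G(0) > 0`. -/
theorem SigmaPrime.exists_disk_coord (f : SigmaPrime) :
    ∃ (G : ℂ → ℂ) (b : ℝ), 0 < b ∧ G 0 = b ∧ DifferentiableOn ℂ G (Metric.ball 0 1) ∧
      (∀ w ∈ Metric.ball (0 : ℂ) 1, G w ≠ 0) ∧
      ∀ z : ExtDisk, (f.toMap z : ℂ) = z * G (z : ℂ)⁻¹ := by
  obtain ⟨b, hb, hlim⟩ := f.at_infty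
  obtain ⟨F, hF, hFf⟩ := f.holomorphic
  have key : ∀ w : ℂ, w ∈ Metric.ball (0 : ℂ) 1 → w ≠ 0 → 1 < ‖w⁻¹‖ := by
    intro w hw hw0
    rw [norm_inv]
    exact (one_lt_inv₀ (norm_pos_iff.2 hw0)).2 (by simpa using hw)
  let G : ℂ → ℂ := Function.update (fun w => w * F w⁻¹) 0 b
  have hGne : ∀ w, w ≠ 0 → G w = w * F w⁻¹ := fun w hw => by simp [G, hw]
  have hG0 : G 0 = b := by simp [G]
  refine ⟨G, b, hb, hG0, ?_, ?_, ?_⟩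
  · rw [← Complex.differentiableOn_compl_singleton_and_continuousAt_iff (c := 0)
      (Metric.ball_mem_nhds 0 one_pos)]
    constructor
    · have h : DifferentiableOn ℂ (fun w : ℂ => w * F w⁻¹) (Metric.ball 0 1 \ {0}) := by
        refine differentiableOn_id.mul (hF.comp ?_ ?_)
        · intro w hw
          exact (differentiableAt_inv hw.2).differentiableWithinAt
        · intro w hw
          exact key w hw.1 hw.2
      exact h.congr fun w hw => hGne w hw.2
    · rw [continuousAt_iff_punctured_nhds, hG0]
      rw [Metric.tendsto_nhds] at hlim ⊢
      intro ε hε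
      have h1 := hlim ε hε
      rw [nearInfty, eventually_comap] at h1
      have h2 : ∀ᶠ w in 𝓝[≠] (0 : ℂ), ∀ a : ExtDisk, ‖(a : ℂ)‖ = ‖w⁻¹‖ →
          dist ((f.toMap a : ℂ) / a) b < ε :=
        (tendsto_norm_cobounded_atTop.comp tendsto_inv₀_nhdsNE_zero).eventually h1
      filter_upwards [h2, self_mem_nhdsWithin,
        mem_nhdsWithin_of_mem_nhds (Metric.ball_mem_nhds (0 : ℂ) one_pos)] with w hw hw0 hwb
      have := hw ⟨w⁻¹, key w hwb hw0⟩ rfl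
      rw [← hFf] at this
      simp only [div_inv_eq_mul] at this
      rw [hGne w hw0, mul_comm]
      exact this
  · intro w hw
    by_cases h0 : w = 0
    · rw [h0, hG0]; exact_mod_cast hb.ne'
    · rw [hGne w h0]
      refine mul_ne_zero h0 ?_
      have := hFf ⟨w⁻¹, key w hw h0⟩
      simp only at this
      rw [this]
      exact norm_pos_iff.1 (one_pos.trans (f.toMap _).2)
  · intro z
    have h2 : (z : ℂ) ≠ 0 := norm_pos_iff.1 (one_pos.trans z.2)
    rw [hGne _ (inv_ne_zero h2), inv_inv, hFf]
    field_simp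

/-- The `n`-th root transform is well defined on `Σ'`. -/
theorem SigmaPrime.exists_koebe (f : SigmaPrime) {n : ℕ} (hn : n ≠ 0) :
    ∃ h : SigmaPrime, ∀ z w : ExtDisk, (w : ℂ) = (z : ℂ) ^ n →
      (h.toMap z : ℂ) ^ n = f.toMap w := by
  obtain ⟨G, b, hb, hG0, hG, hGne, hfG⟩ := f.exists_disk_coord
  have hdG : DifferentiableOn ℂ (deriv G) (Metric.ball 0 1) := hG.deriv Metric.isOpen_ball
  obtain ⟨L, hL0, hL⟩ :=
    ((hdG.div hG hGne).isExactOn_ball).with_val_at (0 : ℂ) (Real.log b : ℂ)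
  have hExp : ∀ w ∈ Metric.ball (0 : ℂ) 1, Complex.exp (L w) = G w := by
    have hd : ∀ w ∈ Metric.ball (0 : ℂ) 1,
        HasDerivAt (fun w => G w * Complex.exp (-L w)) 0 w := by
      intro w hw
      have h1 : HasDerivAt G (deriv G w) w :=
        (hG.differentiableAt (Metric.isOpen_ball.mem_nhds hw)).hasDerivAt
      have h2 := h1.mul (hL w hw).neg.cexp
      refine h2.congr_deriv ?_
      have := hGne w hw
      simp only [Pi.div_apply]
      field_simp
      ring
    intro w hw
    have h0 : (0 : ℂ) ∈ Metric.ball (0 : ℂ) 1 := Metric.mem_ball_self one_pos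
    have hc : G w * Complex.exp (-L w) = G 0 * Complex.exp (-L 0) :=
      Metric.isOpen_ball.is_const_of_deriv_eq_zero (convex_ball (0 : ℂ) 1).isPreconnected
        (fun w hw => (hd w hw).differentiableAt.differentiableWithinAt)
        (fun w hw => (hd w hw).deriv) hw h0
    rw [hL0, hG0, Complex.exp_neg, Complex.exp_neg, ← Complex.ofReal_exp, Real.exp_log hb,
      mul_inv_cancel₀ (by exact_mod_cast hb.ne')] at hc
    have := Complex.exp_ne_zero (L w)
    field_simp at hc
    exact hc.symm
  have hn' : (n : ℂ) ≠ 0 := by exact_mod_cast hn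
  have hz0 : ∀ z : ExtDisk, (z : ℂ) ≠ 0 := fun z => norm_pos_iff.1 (one_pos.trans z.2)
  have hball : ∀ z : ℂ, 1 < ‖z‖ → (z ^ n)⁻¹ ∈ Metric.ball (0 : ℂ) 1 := by
    intro z hz
    rw [mem_ball_zero_iff, norm_inv, norm_pow]
    exact inv_lt_one_of_one_lt₀ (one_lt_pow₀ hz hn)
  let H : ℂ → ℂ := fun z => z * Complex.exp (L (z ^ n)⁻¹ / n)
  have hHn : ∀ z w : ExtDisk, (w : ℂ) = (z : ℂ) ^ n → H z ^ n = f.toMap w := by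
    intro z w hw
    simp only [H]
    rw [mul_pow, ← Complex.exp_nat_mul, mul_div_cancel₀ _ hn', hExp _ (hball z z.2), hfG w, hw]
  have hpow : ∀ z : ExtDisk, 1 < ‖(z : ℂ) ^ n‖ := fun z => by
    rw [norm_pow]; exact one_lt_pow₀ z.2 hn
  have hHd : DifferentiableOn ℂ H {z | 1 < ‖z‖} := by
    have hLd : DifferentiableOn ℂ L (Metric.ball 0 1) := fun w hw =>
      (hL w hw).differentiableAt.differentiableWithinAt
    refine differentiableOn_id.mul (DifferentiableOn.cexp (DifferentiableOn.div_const ?_ _))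
    refine hLd.comp (DifferentiableOn.inv (by fun_prop) ?_) fun z hz => hball z hz
    intro z hz
    exact pow_ne_zero _ (hz0 ⟨z, hz⟩)
  have hH1 : ∀ z : ExtDisk, 1 < ‖H z‖ := by
    intro z
    have h1 := (f.toMap ⟨(z : ℂ) ^ n, hpow z⟩).2
    rw [← hHn z ⟨(z : ℂ) ^ n, hpow z⟩ rfl, norm_pow] at h1
    exact (one_lt_pow_iff_of_nonneg (norm_nonneg _) hn).1 h1
  refine ⟨⟨⟨fun z => ⟨H z, hH1 z⟩, ?_⟩, ?_, ⟨H, hHd, fun z => rfl⟩, ?_⟩, hHn⟩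
  · exact Continuous.subtype_mk (hHd.continuousOn.comp_continuous continuous_subtype_val
      fun z => z.2) _
  · intro z w hzw
    have h0 : H z = H w := congrArg Subtype.val hzw
    have h1 : H z ^ n = H w ^ n := by rw [h0]
    rw [hHn z ⟨(z : ℂ) ^ n, hpow z⟩ rfl, hHn w ⟨(w : ℂ) ^ n, hpow w⟩ rfl] at h1
    have h2 : (z : ℂ) ^ n = (w : ℂ) ^ n :=
      congrArg Subtype.val (f.injective (Subtype.ext h1))
    simp only [H, h2] at h0
    exact Subtype.ext (mul_right_cancel₀ (Complex.exp_ne_zero _) h0)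
  · refine ⟨Real.exp (Real.log b / n), Real.exp_pos _, ?_⟩
    have hlimz : Tendsto (fun z : ExtDisk => ((z : ℂ) ^ n)⁻¹) nearInfty (𝓝 0) := by
      rw [tendsto_zero_iff_norm_tendsto_zero]
      have h1 : Tendsto (fun z : ExtDisk => ‖(z : ℂ)‖) nearInfty atTop := tendsto_comap
      refine (((tendsto_pow_atTop hn).comp h1).inv_tendsto_atTop).congr fun z => ?_
      simp
    have hLc : ContinuousAt L 0 := (hL 0 (Metric.mem_ball_self one_pos)).continuousAt
    have h2 := ((hLc.tendsto.comp hlimz).div_const (n : ℂ)).cexp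
    rw [hL0] at h2
    push_cast
    refine h2.congr fun z => ?_
    have := hz0 z
    simp only [Function.comp, ContinuousMap.coe_mk, H]
    field_simp

open Classical in
/-- The Koebe `n`-root transform `K_n f`: the map `h ∈ Σ'` with `h(z)^n = f(z^n)`, for `n ≥ 1`.
(Membership in `Σ'` selects the branch of the root with positive derivative at infinity.) -/
def SigmaPrime.koebe (n : ℕ) (f : SigmaPrime) : SigmaPrime :=
  if hn : n ≠ 0 then (f.exists_koebe hn).choose else f

theorem SigmaPrime.koebe_pow (f : SigmaPrime) {n : ℕ} (hn : n ≠ 0) (z w : ExtDisk)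
    (hw : (w : ℂ) = (z : ℂ) ^ n) : ((f.koebe n).toMap z : ℂ) ^ n = f.toMap w := by
  rw [SigmaPrime.koebe, dif_pos hn]
  exact (f.exists_koebe hn).choose_spec z w hw

instance : Nonempty SigmaPrime :=
  ⟨⟨ContinuousMap.id _, fun _ _ h => h, ⟨id, differentiableOn_id, fun _ => rfl⟩, 1, one_pos, by
    refine tendsto_const_nhds.congr fun z => ?_
    have : (z : ℂ) ≠ 0 := norm_pos_iff.1 (one_pos.trans z.2)
    simp [this]⟩⟩

/-- The approximations `f_0 = φ_{θ_0}`, `f_n = f_{n-1} ∘ K_{k^n} φ_{θ_n}`. -/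
def approx (φ : SigmaPrime) (k : ℕ) (θ : ℕ → Angles) : ℕ → SigmaPrime
  | 0 => φ.rotate (θ 0)
  | n + 1 => (approx φ k θ n).comp ((φ.rotate (θ (n + 1))).koebe (k ^ (n + 1)))

/-- The conformal snowflake `f = lim f_n` with building block `φ`, integer `k` and rotations
`θ_0, θ_1, …`; the limit is that of uniform convergence on compact sets. -/
def snowflake (φ : SigmaPrime) (k : ℕ) (θ : ℕ → Angles) : SigmaPrime :=
  limUnder atTop (approx φ k θ)

/-- The transformation `(f, θ) ↦ φ_θ(K_k f)` from `Σ' × 𝕋` to `Σ'`. -/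
def step (φ : SigmaPrime) (k : ℕ) (f : SigmaPrime) (θ : Angles) : SigmaPrime :=
  (φ.rotate θ).comp (f.koebe k)

/-- The inverse map `f⁻¹`, as a partial map of the exterior disk whose domain is the range of
`f`. -/
def SigmaPrime.inv (f : SigmaPrime) : ExtDisk →. ExtDisk :=
  fun z => ⟨∃ w, f.toMap w = z, fun h => h.choose⟩

theorem SigmaPrime.mem_inv (f : SigmaPrime) (z w : ExtDisk) :
    w ∈ f.inv z ↔ f.toMap w = z := by
  constructor
  · rintro ⟨h, rfl⟩
    exact h.choose_spec
  · intro h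
    exact ⟨⟨w, h⟩, f.injective ((Exists.choose_spec (⟨w, h⟩ : ∃ w, f.toMap w = z)).trans h.symm)⟩

/-- `g_θ(z) = e^{iθ} g(e^{-iθ} z)` for a partial map `g`, with domain the rotated domain. -/
def rotatePartial (θ : Angles) (g : ExtDisk →. ExtDisk) : ExtDisk →. ExtDisk :=
  fun z => (g (rotPt (-θ) z)).map (rotPt θ)

/-- `h` is the Koebe `n`-root transform of the partial map `g`: it is defined at `z` exactly when
`g` is defined at `z^n`, it is a continuous branch of the root `g(z^n)^{1/n}`, and `h(z) / z` has
a positive limit at infinity. -/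
structure IsKoebePartial (n : ℕ) (g h : ExtDisk →. ExtDisk) : Prop where
  dom_iff : ∀ z w : ExtDisk, (w : ℂ) = (z : ℂ) ^ n → (z ∈ h.Dom ↔ w ∈ g.Dom)
  pow_eq : ∀ z w : ExtDisk, (w : ℂ) = (z : ℂ) ^ n →
    ∀ x ∈ h z, ∀ y ∈ g w, (x : ℂ) ^ n = y
  continuous_fn : Continuous fun z : h.Dom => h.fn z.1 z.2
  at_infty : ∃ c : ℝ, 0 < c ∧ Tendsto (fun z : h.Dom => (h.fn z.1 z.2 : ℂ) / ((z : ExtDisk) : ℂ))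
    (comap Subtype.val nearInfty) (𝓝 (c : ℂ))

open Classical in
/-- The Koebe `n`-root transform `z ↦ g(z^n)^{1/n}` of a partial map `g` of the exterior disk. -/
def koebePartial (n : ℕ) (g : ExtDisk →. ExtDisk) : ExtDisk →. ExtDisk :=
  if h : ∃ h, IsKoebePartial n g h then h.choose else g

/-- The σ-algebra on the space of partial maps generated by the evaluations: by the events
"`g` is defined at `z` and `g(z) ∈ B`" for points `z` and Borel sets `B`. -/
instance : MeasurableSpace (ExtDisk →. ExtDisk) :=
  MeasurableSpace.generateFrom
    {S | ∃ (z : ExtDisk) (B : Set ExtDisk), MeasurableSet B ∧ S = {g | ∃ x ∈ g z, x ∈ B}}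

/-- A continuous branch of an `n`-th root on a connected space is determined by the condition
that it be asymptotically positive. -/
theorem root_unique {X : Type*} [TopologicalSpace X] [PreconnectedSpace X] {l : Filter X} [l.NeBot]
    {n : ℕ} (hn : n ≠ 0) {u v : X → ℂ} (hu : Continuous u) (hv : Continuous v)
    (hv0 : ∀ x, v x ≠ 0) (huv : ∀ x, u x ^ n = v x ^ n) {c : ℝ} (hc : 0 < c)
    (hlim : Tendsto (fun x => u x / v x) l (𝓝 (c : ℂ))) : u = v := by
  have hq : Continuous fun x => u x / v x := hu.div hv hv0
  have hqn : ∀ x, (u x / v x) ^ n = 1 := fun x => by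
    rw [div_pow, huv, div_self (pow_ne_zero _ (hv0 x))]
  have hfin : Set.Finite {w : ℂ | w ^ n = 1} := by
    refine (Polynomial.nthRootsFinset n (1 : ℂ)).finite_toSet.subset fun w hw => ?_
    rw [Finset.mem_coe, Polynomial.mem_nthRootsFinset (Nat.pos_of_ne_zero hn)]
    exact hw
  have hconst : ∀ x y, u x / v x = u y / v y := by
    intro x y
    have : (range fun x => u x / v x).Subsingleton :=
      (hfin.subset (by rintro _ ⟨x, rfl⟩; exact hqn x)).countable.isTotallyDisconnected _ subset_rfl
        (isPreconnected_range hq)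
    exact this ⟨x, rfl⟩ ⟨y, rfl⟩
  obtain ⟨x₀⟩ : Nonempty X := l.nonempty_of_neBot
  have h1 : u x₀ / v x₀ = c :=
    tendsto_nhds_unique (tendsto_const_nhds.congr fun x => hconst x₀ x) hlim
  have h2 : c = 1 := by
    have := hqn x₀
    rw [h1] at this
    exact (pow_eq_one_iff_of_nonneg hc.le hn).1 (by exact_mod_cast this)
  funext x
  have := hconst x x₀
  rw [h1, h2, div_eq_iff (hv0 x)] at this
  simpa using this

instance : PreconnectedSpace ExtDisk := by
  have h : IsPreconnected (Complex.exp '' {z : ℂ | 0 < z.re}) :=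
    (convex_halfSpace_re_gt 0).isPreconnected.image _ Complex.continuous_exp.continuousOn
  have h2 : Complex.exp '' {z : ℂ | 0 < z.re} = {z : ℂ | 1 < ‖z‖} := by
    ext z
    constructor
    · rintro ⟨w, hw, rfl⟩
      simpa [Complex.norm_exp] using hw
    · intro hz
      refine ⟨Complex.log z, ?_, Complex.exp_log (norm_pos_iff.1 (one_pos.trans hz))⟩
      simpa [Complex.log_re] using Real.log_pos hz
  rw [h2] at h
  exact isPreconnected_iff_preconnectedSpace.1 h

instance : nearInfty.NeBot := by
  rw [nearInfty, comap_neBot_iff_frequently]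
  refine Eventually.frequently ?_
  filter_upwards [eventually_gt_atTop 1] with r hr
  exact ⟨⟨(r : ℂ), by simpa [abs_of_pos (one_pos.trans hr)] using hr⟩,
    by simp [abs_of_pos (one_pos.trans hr)]⟩

theorem SigmaPrime.koebe_unique (f h : SigmaPrime) {n : ℕ} (hn : n ≠ 0)
    (hh : ∀ z w : ExtDisk, (w : ℂ) = (z : ℂ) ^ n → (h.toMap z : ℂ) ^ n = f.toMap w) :
    h = f.koebe n := by
  have h0 : ∀ z : ExtDisk, (z : ℂ) ≠ 0 := fun z => norm_pos_iff.1 (one_pos.trans z.2)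
  obtain ⟨b, hb, hlim⟩ := h.at_infty
  obtain ⟨c, hc, hlim'⟩ := (f.koebe n).at_infty
  have key := root_unique (l := nearInfty) hn (u := fun z => (h.toMap z : ℂ))
    (v := fun z => ((f.koebe n).toMap z : ℂ)) (by fun_prop) (by fun_prop) (fun z => h0 _)
    (fun z => ?_) (div_pos hb hc) ?_
  · exact SigmaPrime.ext_map fun z => Subtype.ext (congrFun key z)
  · have hz : 1 < ‖(z : ℂ) ^ n‖ := by rw [norm_pow]; exact one_lt_pow₀ z.2 hn
    rw [hh z ⟨_, hz⟩ rfl, f.koebe_pow hn z ⟨_, hz⟩ rfl]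
  · push_cast
    refine (hlim.div hlim' (by exact_mod_cast hc.ne')).congr fun z => ?_
    have := h0 z
    have := h0 ((f.koebe n).toMap z)
    simp only [Pi.div_apply]
    field_simp

/-- Points whose images are near infinity are near infinity. -/
theorem SigmaPrime.comap_nearInfty_le (f : SigmaPrime) :
    comap f.toMap nearInfty ≤ nearInfty := by
  obtain ⟨G, b, hb, hG0, hG, hGne, hfG⟩ := f.exists_disk_coord
  have h0b : (0 : ℂ) ∈ Metric.ball (0 : ℂ) 1 := Metric.mem_ball_self one_pos
  have hGa : AnalyticAt ℂ G 0 :=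
    hG.analyticAt (Metric.isOpen_ball.mem_nhds h0b)
  have hΦa : AnalyticAt ℂ (fun w => w / G w) 0 := analyticAt_id.div hGa (hGne 0 h0b)
  have hΦd : HasStrictDerivAt (fun w => w / G w) (b : ℂ)⁻¹ 0 := by
    have h1 := (hasDerivAt_id (0 : ℂ)).div hGa.differentiableAt.hasDerivAt (hGne 0 h0b)
    have h2 : deriv (fun w => w / G w) 0 = (b : ℂ)⁻¹ := by
      have hbc : (b : ℂ) ≠ 0 := by exact_mod_cast hb.ne'
      refine (h1.deriv).trans ?_
      simp only [id, hG0]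
      field_simp
      simp
    rw [← h2]
    exact hΦa.hasStrictDerivAt
  have hmap := hΦd.map_nhds_eq (inv_ne_zero (by exact_mod_cast hb.ne'))
  rw [zero_div] at hmap
  intro S hS
  rw [nearInfty, mem_comap] at hS
  obtain ⟨T, hT, hTS⟩ := hS
  obtain ⟨R, hR⟩ := mem_atTop_sets.1 hT
  have hεpos : 0 < min 1 (1 + |R|)⁻¹ := by positivity
  have hmem : (fun w => w / G w) '' Metric.ball 0 (min 1 (1 + |R|)⁻¹) ∈ 𝓝 (0 : ℂ) := by
    rw [← hmap]
    exact image_mem_map (Metric.ball_mem_nhds 0 hεpos)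
  have hinv : Tendsto (fun u : ExtDisk => ((f.toMap u : ℂ))⁻¹) (comap f.toMap nearInfty)
      (𝓝 0) := by
    rw [tendsto_zero_iff_norm_tendsto_zero]
    have h1 : Tendsto (fun u : ExtDisk => ‖(f.toMap u : ℂ)‖) (comap f.toMap nearInfty) atTop :=
      (tendsto_comap (f := fun z : ExtDisk => ‖(z : ℂ)‖)).comp tendsto_comap
    refine h1.inv_tendsto_atTop.congr fun u => ?_
    simp
  filter_upwards [hinv hmem] with u hu
  obtain ⟨w, hw, hwu⟩ := hu
  simp only at hwu
  have hfu : (f.toMap u : ℂ) ≠ 0 := norm_pos_iff.1 (one_pos.trans (f.toMap u).2)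
  have hw0 : w ≠ 0 := by
    rintro rfl
    rw [zero_div] at hwu
    exact inv_ne_zero hfu hwu.symm
  rw [mem_ball_zero_iff, lt_min_iff] at hw
  have hw1 : 1 < ‖w⁻¹‖ := by
    rw [norm_inv]; exact (one_lt_inv₀ (norm_pos_iff.2 hw0)).2 hw.1
  have hwu' : u = ⟨w⁻¹, hw1⟩ := by
    apply f.injective
    apply Subtype.ext
    rw [hfG ⟨w⁻¹, hw1⟩, inv_inv, ← inv_inv (f.toMap u : ℂ), ← hwu, inv_div]
    field_simp
  apply hTS
  apply hR
  rw [hwu']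
  have h3 : 1 + |R| < ‖w⁻¹‖ := by
    rw [norm_inv]
    exact (lt_inv_comm₀ (norm_pos_iff.2 hw0) (by positivity)).1 hw.2
  have := le_abs_self R
  change R ≤ ‖w⁻¹‖
  linarith

theorem SigmaPrime.isOpenMap (f : SigmaPrime) : IsOpenMap f.toMap := by
  obtain ⟨F, hF, hFf⟩ := f.holomorphic
  have hopen : IsOpen {z : ℂ | 1 < ‖z‖} := isOpen_lt continuous_const continuous_norm
  have hpre : IsPreconnected {z : ℂ | 1 < ‖z‖} := isPreconnected_iff_preconnectedSpace.2
    (inferInstanceAs (PreconnectedSpace ExtDisk))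
  rcases (hF.analyticOnNhd hopen).is_constant_or_isOpen hpre with ⟨w, hw⟩ | h
  · exfalso
    have h2 : (1 : ℝ) < ‖(2 : ℂ)‖ := by simp
    have h3 : (1 : ℝ) < ‖(3 : ℂ)‖ := by simp
    have := f.injective (a₁ := ⟨2, h2⟩) (a₂ := ⟨3, h3⟩) (Subtype.ext (by
      rw [← hFf, ← hFf, hw _ h2, hw _ h3]))
    have := congrArg Subtype.val this
    norm_num at this
  · intro s hs
    have h1 : IsOpen (Subtype.val '' s) := hopen.isOpenMap_subtype_val s hs
    have h2 := h (Subtype.val '' s) (by rintro _ ⟨x, -, rfl⟩; exact x.2) h1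
    have h3 : f.toMap '' s = Subtype.val ⁻¹' (F '' (Subtype.val '' s)) := by
      ext z
      simp only [mem_image, mem_preimage, exists_exists_and_eq_and, hFf]
      exact ⟨fun ⟨x, hx, hxz⟩ => ⟨x, hx, by rw [hxz]⟩, fun ⟨x, hx, hxz⟩ => ⟨x, hx, Subtype.ext hxz⟩⟩
    rw [h3]
    exact h2.preimage continuous_subtype_val

/-- The Koebe transform of `f⁻¹` exists, is unique, and is the inverse of that of `f`. -/
theorem isKoebePartial_inv_iff (f : SigmaPrime) {n : ℕ} (hn : n ≠ 0) (h : ExtDisk →. ExtDisk) :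
    IsKoebePartial n f.inv h ↔ h = (f.koebe n).inv := by
  have hz0 : ∀ z : ExtDisk, (z : ℂ) ≠ 0 := fun z => norm_pos_iff.1 (one_pos.trans z.2)
  have hpow : ∀ z : ExtDisk, 1 < ‖(z : ℂ) ^ n‖ := fun z => by
    rw [norm_pow]; exact one_lt_pow₀ z.2 hn
  have hdom : ∀ (f : SigmaPrime) (z : ExtDisk), z ∈ f.inv.Dom ↔ ∃ w, f.toMap w = z :=
    fun f z => Iff.rfl
  have hfn : ∀ (f : SigmaPrime) (z : f.inv.Dom), f.toMap (f.inv.fn z.1 z.2) = z.1 := fun f z =>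
    (f.mem_inv _ _).1 (Part.get_mem _)
  obtain ⟨b, hb, hlim⟩ := (f.koebe n).at_infty
  have hK : IsKoebePartial n f.inv (f.koebe n).inv := by
    constructor
    · intro z w hw
      rw [hdom, hdom]
      constructor
      · rintro ⟨u, rfl⟩
        refine ⟨⟨(u : ℂ) ^ n, hpow u⟩, Subtype.ext ?_⟩
        rw [hw, ← f.koebe_pow hn u ⟨_, hpow u⟩ rfl]
      · rintro ⟨v, rfl⟩
        obtain ⟨ζ, hζ⟩ := IsAlgClosed.exists_pow_nat_eq (v : ℂ) (Nat.pos_of_ne_zero hn)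
        have hζ1 : 1 < ‖ζ‖ := by
          have := v.2
          rw [← hζ, norm_pow] at this
          exact (one_lt_pow_iff_of_nonneg (norm_nonneg _) hn).1 this
        have h1 : ((f.koebe n).toMap ⟨ζ, hζ1⟩ : ℂ) ^ n = z ^ n := by
          rw [f.koebe_pow hn ⟨ζ, hζ1⟩ v hζ.symm, hw]
        let q : ℂ := z / (f.koebe n).toMap ⟨ζ, hζ1⟩
        have hq : q ^ n = 1 := by
          simp only [q]
          rw [div_pow, h1, div_self (pow_ne_zero _ (hz0 z))]
        have hqn : ‖q‖ = 1 := by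
          have := congrArg norm hq
          rw [norm_pow, norm_one] at this
          exact (pow_eq_one_iff_of_nonneg (norm_nonneg _) hn).1 this
        have hq0 : q ≠ 0 := norm_pos_iff.1 (by rw [hqn]; exact one_pos)
        -- the Koebe transform commutes with multiplication by `n`-th roots of unity
        have hrot : ∀ x : ExtDisk, 1 < ‖q * (x : ℂ)‖ := fun x => by
          rw [norm_mul, hqn, one_mul]; exact x.2
        have hcont : Continuous fun x : ExtDisk => (⟨q * x, hrot x⟩ : ExtDisk) := by fun_prop
        have htend : Tendsto (fun x : ExtDisk => (⟨q * x, hrot x⟩ : ExtDisk))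
            nearInfty nearInfty := by
          rw [nearInfty, tendsto_comap_iff]
          refine tendsto_comap.congr fun x => ?_
          simp [hqn]
        have key := root_unique (l := nearInfty) hn
          (u := fun x : ExtDisk => ((f.koebe n).toMap ⟨q * x, hrot x⟩ : ℂ) / q)
          (v := fun x => ((f.koebe n).toMap x : ℂ)) ?_ (by fun_prop) (fun x => hz0 _)
          (fun x => ?_) one_pos ?_
        · refine ⟨⟨q * ζ, hrot ⟨ζ, hζ1⟩⟩, Subtype.ext ?_⟩
          have := congrFun key ⟨ζ, hζ1⟩
          simp only at this
          rw [div_eq_iff hq0] at this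
          rw [this]
          simp only [q]
          have := hz0 ((f.koebe n).toMap ⟨ζ, hζ1⟩)
          field_simp
        · exact ((continuous_subtype_val.comp
            ((f.koebe n).toMap.continuous.comp hcont))).div_const q
        · rw [div_pow, hq, div_one, f.koebe_pow hn x ⟨_, hpow x⟩ rfl,
            f.koebe_pow hn ⟨q * x, hrot x⟩ ⟨_, hpow x⟩ (by simp [mul_pow, hq])]
        · have h2 := (hlim.comp htend).div hlim (by exact_mod_cast hb.ne')
          rw [div_self (by exact_mod_cast hb.ne')] at h2
          push_cast
          refine h2.congr fun x => ?_
          have := hz0 x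
          have := hz0 ((f.koebe n).toMap x)
          simp only [Pi.div_apply, Function.comp]
          field_simp
    · intro z w hw x hx y hy
      rw [SigmaPrime.mem_inv] at hx hy
      have h1 : f.toMap ⟨(x : ℂ) ^ n, hpow x⟩ = f.toMap y := Subtype.ext (by
        rw [← f.koebe_pow hn x ⟨_, hpow x⟩ rfl, hx, hy, hw])
      exact congrArg Subtype.val (f.injective h1)
    · rw [continuous_def]
      intro s hs
      have h1 : (fun z : (f.koebe n).inv.Dom => (f.koebe n).inv.fn z.1 z.2) ⁻¹' s =
          Subtype.val ⁻¹' ((f.koebe n).toMap '' s) := by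
        ext z
        constructor
        · intro hz
          exact ⟨_, hz, hfn _ z⟩
        · rintro ⟨x, hx, hxz⟩
          have : x = (f.koebe n).inv.fn z.1 z.2 :=
            (f.koebe n).injective (hxz.trans (hfn _ z).symm)
          rw [mem_preimage, ← this]
          exact hx
      rw [h1]
      exact ((f.koebe n).isOpenMap s hs).preimage continuous_subtype_val
    · refine ⟨b⁻¹, inv_pos.2 hb, ?_⟩
      have htend : Tendsto (fun z : (f.koebe n).inv.Dom => (f.koebe n).inv.fn z.1 z.2)
          (comap Subtype.val nearInfty) nearInfty := by
        refine Tendsto.mono_right ?_ (f.koebe n).comap_nearInfty_le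
        rw [tendsto_comap_iff]
        refine tendsto_comap.congr fun z => ?_
        exact (hfn _ z).symm
      have h2 := (hlim.comp htend).inv₀ (by exact_mod_cast hb.ne')
      push_cast
      refine h2.congr fun z => ?_
      simp only [Function.comp]
      rw [hfn, inv_div]
  refine ⟨fun hh => ?_, fun hh => hh ▸ hK⟩
  have hD : ∀ z, z ∈ h.Dom ↔ ∃ u, (f.koebe n).toMap u = z := fun z => by
    rw [hh.dom_iff z ⟨_, hpow z⟩ rfl, ← hK.dom_iff z ⟨_, hpow z⟩ rfl, hdom]
  obtain ⟨c, hc, hlimh⟩ := hh.at_infty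
  let j : ExtDisk → h.Dom := fun u => ⟨(f.koebe n).toMap u, (hD _).2 ⟨u, rfl⟩⟩
  have hj : Continuous j := Continuous.subtype_mk (f.koebe n).toMap.continuous _
  have key := root_unique (l := nearInfty) hn
    (u := fun x : ExtDisk => (h.fn (j x).1 (j x).2 : ℂ)) (v := fun x => (x : ℂ))
    (continuous_subtype_val.comp (hh.continuous_fn.comp hj)) continuous_subtype_val hz0
    (fun x => ?_) (mul_pos hc hb) ?_
  · refine PFun.ext fun z w => ?_
    rw [SigmaPrime.mem_inv]
    have hval : ∀ u, u ∈ h ((f.koebe n).toMap u) := fun u => by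
      have h1 : h.fn (j u).1 (j u).2 = u := Subtype.ext (congrFun key u)
      exact ⟨(j u).2, h1⟩
    constructor
    · intro hw
      obtain ⟨u, rfl⟩ := (hD z).1 (Part.dom_iff_mem.2 ⟨w, hw⟩)
      rw [Part.mem_unique hw (hval u)]
    · rintro rfl
      exact hval w
  · refine hh.pow_eq (j x).1 ⟨_, hpow _⟩ rfl _ (Part.get_mem _) ⟨(x : ℂ) ^ n, hpow x⟩ ?_
    rw [SigmaPrime.mem_inv]
    exact Subtype.ext (f.koebe_pow hn x ⟨_, hpow x⟩ rfl).symm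
  · have htend : Tendsto j nearInfty (comap Subtype.val nearInfty) := by
      rw [tendsto_comap_iff]
      exact (f.koebe n).tendsto_nearInfty
    push_cast
    refine ((hlimh.comp htend).mul hlim).congr fun x => ?_
    have := hz0 x
    have := hz0 ((f.koebe n).toMap x)
    simp only [Function.comp, j]
    field_simp

theorem koebePartial_inv (f : SigmaPrime) {n : ℕ} (hn : n ≠ 0) :
    koebePartial n f.inv = (f.koebe n).inv := by
  have h : ∃ h, IsKoebePartial n f.inv h := ⟨_, (isKoebePartial_inv_iff f hn _).2 rfl⟩
  rw [koebePartial, dif_pos h]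
  exact (isKoebePartial_inv_iff f hn _).1 h.choose_spec

end Snowflake

namespace Snowflake

/-! The snowflake is self-similar. Since `K_k` respects composition and `K_k K_{k^n} = K_{k^(n+1)}`,
the approximations satisfy `f_{n+1}(θ) = φ_{θ_0} ∘ K_k f_n(shift θ)` (`approx_succ`), and in the
limit the snowflake of `θ` is `step` applied to the snowflake of the shifted sequence and `θ_0`
(`snowflake_eq_step`). Prepending an independent uniform angle to an i.i.d. sequence of uniform
angles again gives such a sequence, so the law of the snowflake is invariant under `step`.

The analytic work makes this legitimate. Writing `φ(z) = z exp(L(1/z))`, one has `K_n φ_θ(z) = z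
exp(L(e^{iθ}/z^n)/n)`, which is within `O(|z|/n)` of the identity for `|z| ≥ r > 1`, uniformly in
`θ`. The `f_n` therefore have uniformly linear growth, hence are uniformly Lipschitz away from the
unit circle, and their increments are geometrically small; Hurwitz's theorem keeps the limit
univalent (`tendsto_approx`). Continuity of composition, rotation and `K_k` makes `step` continuous
and the snowflake a measurable function of `θ`.

For inverses, `f ↦ f⁻¹` is measurable because `{f | z ∈ f(B)}` is open for open `B`, again by
Hurwitz, and inversion commutes with Koebe transforms and rotations (`inv_step`). The second
identity in law is thus the image of the first. -/

/-! ### Root transforms: logarithmic coordinate, algebra, and the recursion. -/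

theorem ExtDisk.ne_zero (z : ExtDisk) : (z : ℂ) ≠ 0 := norm_pos_iff.1 (one_pos.trans z.2)

theorem ExtDisk.one_lt_norm_pow (z : ExtDisk) {n : ℕ} (hn : n ≠ 0) : 1 < ‖(z : ℂ) ^ n‖ := by
  rw [norm_pow]; exact one_lt_pow₀ z.2 hn

/-- The power map of the exterior disk. -/
def powPt (n : ℕ) (hn : n ≠ 0) (z : ExtDisk) : ExtDisk := ⟨(z : ℂ) ^ n, z.one_lt_norm_pow hn⟩

theorem inv_mem_ball (z : ExtDisk) : (z : ℂ)⁻¹ ∈ Metric.ball (0 : ℂ) 1 := by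
  rw [mem_ball_zero_iff, norm_inv]
  exact inv_lt_one_of_one_lt₀ z.2

theorem tendsto_inv_nearInfty : Tendsto (fun z : ExtDisk => (z : ℂ)⁻¹) nearInfty (𝓝 0) := by
  rw [tendsto_zero_iff_norm_tendsto_zero]
  have h1 : Tendsto (fun z : ExtDisk => ‖(z : ℂ)‖) nearInfty atTop := tendsto_comap
  refine h1.inv_tendsto_atTop.congr fun z => ?_
  simp

theorem tendsto_powPt {n : ℕ} (hn : n ≠ 0) : Tendsto (powPt n hn) nearInfty nearInfty := by
  rw [nearInfty, tendsto_comap_iff]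
  have h1 : Tendsto (fun z : ExtDisk => ‖(z : ℂ)‖) nearInfty atTop := tendsto_comap
  refine ((tendsto_pow_atTop hn).comp h1).congr fun z => ?_
  simp [powPt]

theorem continuous_powPt {n : ℕ} (hn : n ≠ 0) : Continuous (powPt n hn) := by
  unfold powPt; fun_prop

theorem SigmaPrime.koebe_pow' (f : SigmaPrime) {n : ℕ} (hn : n ≠ 0) (z : ExtDisk) :
    ((f.koebe n).toMap z : ℂ) ^ n = f.toMap (powPt n hn z) :=
  f.koebe_pow hn z _ rfl

/-- The logarithmic coordinate at infinity: `f(z) = z exp(L(1/z))` with `L` holomorphic in the unit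
disk and real at the origin. -/
theorem SigmaPrime.exists_log (f : SigmaPrime) :
    ∃ (L : ℂ → ℂ) (β : ℝ), L 0 = β ∧ DifferentiableOn ℂ L (Metric.ball 0 1) ∧
      ∀ z : ExtDisk, (f.toMap z : ℂ) = z * Complex.exp (L (z : ℂ)⁻¹) := by
  obtain ⟨G, b, hb, hG0, hG, hGne, hfG⟩ := f.exists_disk_coord
  have hdG : DifferentiableOn ℂ (deriv G) (Metric.ball 0 1) := hG.deriv Metric.isOpen_ball
  obtain ⟨L, hL0, hL⟩ :=
    ((hdG.div hG hGne).isExactOn_ball).with_val_at (0 : ℂ) (Real.log b : ℂ)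
  refine ⟨L, Real.log b, hL0, fun w hw => (hL w hw).differentiableAt.differentiableWithinAt,
    fun z => ?_⟩
  have hd : ∀ w ∈ Metric.ball (0 : ℂ) 1,
      HasDerivAt (fun w => G w * Complex.exp (-L w)) 0 w := by
    intro w hw
    have h1 : HasDerivAt G (deriv G w) w :=
      (hG.differentiableAt (Metric.isOpen_ball.mem_nhds hw)).hasDerivAt
    have h2 := h1.mul (hL w hw).neg.cexp
    refine h2.congr_deriv ?_
    have := hGne w hw
    simp only [Pi.div_apply]
    field_simp
    ring
  have hc : G (z : ℂ)⁻¹ * Complex.exp (-L (z : ℂ)⁻¹) = G 0 * Complex.exp (-L 0) :=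
    Metric.isOpen_ball.is_const_of_deriv_eq_zero (convex_ball (0 : ℂ) 1).isPreconnected
      (fun w hw => (hd w hw).differentiableAt.differentiableWithinAt)
      (fun w hw => (hd w hw).deriv) (inv_mem_ball z) (Metric.mem_ball_self one_pos)
  rw [hL0, hG0, Complex.exp_neg, Complex.exp_neg, ← Complex.ofReal_exp, Real.exp_log hb,
    mul_inv_cancel₀ (by exact_mod_cast hb.ne')] at hc
  have := Complex.exp_ne_zero (L (z : ℂ)⁻¹)
  rw [mul_inv_eq_one₀ this] at hc
  rw [hfG, hc]

/-- Both sides are continuous `n`-th roots of the same function with a positive limiting quotient,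
so `root_unique` applies. The formula makes the `1/n` closeness of `K_n f` to a multiple-free
identity visible in the exponent. -/
theorem SigmaPrime.koebe_apply_of_log (f : SigmaPrime) {n : ℕ} (hn : n ≠ 0) {L : ℂ → ℂ} {β : ℝ}
    (hL0 : L 0 = β) (hL : ContinuousOn L (Metric.ball 0 1))
    (hf : ∀ z : ExtDisk, (f.toMap z : ℂ) = z * Complex.exp (L (z : ℂ)⁻¹)) (z : ExtDisk) :
    ((f.koebe n).toMap z : ℂ) = z * Complex.exp (L ((z : ℂ) ^ n)⁻¹ / n) := by
  have hn' : (n : ℂ) ≠ 0 := by exact_mod_cast hn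
  obtain ⟨b, hb, hlim⟩ := (f.koebe n).at_infty
  have hcont : Continuous fun z : ExtDisk => L ((z : ℂ) ^ n)⁻¹ := by
    refine hL.comp_continuous (f := fun z : ExtDisk => ((z : ℂ) ^ n)⁻¹) ?_
      (fun z => inv_mem_ball (powPt n hn z))
    exact Continuous.inv₀ (by fun_prop) fun z => pow_ne_zero _ z.ne_zero
  have hLlim : Tendsto (fun z : ExtDisk => L ((z : ℂ) ^ n)⁻¹) nearInfty (𝓝 β) := by
    rw [← hL0]
    exact ((hL.continuousAt (Metric.ball_mem_nhds 0 one_pos)).tendsto.comp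
      (tendsto_inv_nearInfty.comp (tendsto_powPt hn)) :)
  refine congrFun (root_unique (l := nearInfty) hn
    (u := fun z => ((f.koebe n).toMap z : ℂ))
    (v := fun z : ExtDisk => (z : ℂ) * Complex.exp (L ((z : ℂ) ^ n)⁻¹ / n))
    (by fun_prop) (continuous_subtype_val.mul (hcont.div_const _).cexp) (fun z => mul_ne_zero z.ne_zero (Complex.exp_ne_zero _))
    (fun z => ?_) (c := b / Real.exp (β / n)) (by positivity) ?_) z
  · rw [f.koebe_pow' hn, hf, mul_pow, ← Complex.exp_nat_mul, mul_div_cancel₀ _ hn']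
    rfl
  · push_cast
    refine (hlim.div (hLlim.div_const (n : ℂ)).cexp (Complex.exp_ne_zero _)).congr fun z => ?_
    have := z.ne_zero
    simp only [Pi.div_apply]
    field_simp

/-- Maps in `Σ'` increase the modulus. -/
theorem SigmaPrime.norm_le (f : SigmaPrime) (z : ExtDisk) : ‖(z : ℂ)‖ ≤ ‖(f.toMap z : ℂ)‖ := by
  obtain ⟨G, b, hb, hG0, hG, hGne, hfG⟩ := f.exists_disk_coord
  -- Schwarz's lemma for `w / G w = 1 / f(1/w)`, a map of the unit disk into its closure fixing `0`.
  have h := Complex.norm_le_norm_of_mapsTo_ball (f := fun w => w / G w) (R := 1) (z := (z : ℂ)⁻¹)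
    (differentiableOn_id.div hG hGne) ?_ (by simp) (mem_ball_zero_iff.1 (inv_mem_ball z))
  · rw [norm_div, norm_inv] at h
    rw [hfG, norm_mul]
    have h1 : 0 < ‖(z : ℂ)‖ := norm_pos_iff.2 z.ne_zero
    have h2 : 0 < ‖G (z : ℂ)⁻¹‖ := norm_pos_iff.2 (hGne _ (inv_mem_ball z))
    rw [div_le_iff₀ h2] at h
    have h3 : 1 ≤ ‖G (z : ℂ)⁻¹‖ := by
      by_contra hlt
      push Not at hlt
      exact absurd h (not_le.2 (mul_lt_of_lt_one_right (inv_pos.2 h1) hlt))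
    exact le_mul_of_one_le_right h1.le h3
  · intro w hw
    rcases eq_or_ne w 0 with rfl | hw0
    · simp
    · have hw1 : 1 < ‖w⁻¹‖ := by
        rw [norm_inv]; exact (one_lt_inv₀ (norm_pos_iff.2 hw0)).2 (by simpa using hw)
      have h1 := (f.toMap ⟨w⁻¹, hw1⟩).2
      rw [hfG ⟨w⁻¹, hw1⟩, inv_inv] at h1
      rw [mem_closedBall_zero_iff]
      change ‖w / G w‖ ≤ 1
      rw [← inv_inv (w / G w), inv_div, norm_inv, div_eq_inv_mul]
      exact (inv_lt_one_of_one_lt₀ h1).le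

theorem SigmaPrime.koebe_comp (f g : SigmaPrime) {n : ℕ} (hn : n ≠ 0) :
    (f.comp g).koebe n = (f.koebe n).comp (g.koebe n) := by
  symm
  refine (f.comp g).koebe_unique _ hn fun z w hw => ?_
  exact f.koebe_pow hn ((g.koebe n).toMap z) (g.toMap w) (g.koebe_pow hn z w hw).symm

theorem SigmaPrime.koebe_koebe (f : SigmaPrime) {m n : ℕ} (hm : m ≠ 0) (hn : n ≠ 0) :
    (f.koebe m).koebe n = f.koebe (m * n) := by
  refine f.koebe_unique _ (mul_ne_zero hm hn) fun z w hw => ?_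
  rw [mul_comm, pow_mul, (f.koebe m).koebe_pow' hn,
    f.koebe_pow hm (powPt n hn z) w (by rw [hw, mul_comm, pow_mul]; rfl)]

theorem SigmaPrime.koebe_one (f : SigmaPrime) : f.koebe 1 = f :=
  (f.koebe_unique f one_ne_zero fun z w hw => by
    rw [pow_one]; exact congrArg _ (congrArg _ (Subtype.ext (by simpa using hw.symm)))).symm

theorem SigmaPrime.comp_assoc (f g h : SigmaPrime) : (f.comp g).comp h = f.comp (g.comp h) := rfl

/-- The approximations obey the recursion of the random transformation `step`. -/
theorem approx_succ (φ : SigmaPrime) {k : ℕ} (hk : k ≠ 0) (θ : ℕ → Angles) (n : ℕ) :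
    approx φ k θ (n + 1) = step φ k (approx φ k (fun i => θ (i + 1)) n) (θ 0) := by
  induction n with
  | zero => simp [approx, step]
  | succ n ih =>
    -- The last factor is peeled off: `K_k` distributes over the composition and turns `K_{k^(n+1)}`
    -- into `K_{k^(n+2)}`.
    rw [approx, ih, step, step, SigmaPrime.comp_assoc, approx, SigmaPrime.koebe_comp _ _ hk,
      SigmaPrime.koebe_koebe _ (pow_ne_zero _ hk) hk, ← pow_succ]

/-! ### Topology of `Σ'` and continuity of composition, rotation and root transforms. -/

theorem SigmaPrime.isInducing_toMap : IsInducing SigmaPrime.toMap := ⟨rfl⟩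

theorem SigmaPrime.toMap_injective : Function.Injective SigmaPrime.toMap := fun f g h =>
  SigmaPrime.ext_map fun z => by rw [h]

theorem SigmaPrime.isEmbedding_toMap : IsEmbedding SigmaPrime.toMap :=
  ⟨SigmaPrime.isInducing_toMap, SigmaPrime.toMap_injective⟩

instance : LocallyCompactSpace ExtDisk :=
  (isOpen_lt continuous_const continuous_norm : IsOpen {z : ℂ | 1 < ‖z‖}).locallyCompactSpace

/-- Second countability lets continuous maps on products be measurable for the product σ-algebra;
metrizability, below, makes pointwise limits of measurable maps measurable. -/
instance : SecondCountableTopology SigmaPrime :=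
  SigmaPrime.isEmbedding_toMap.secondCountableTopology

instance : TopologicalSpace.MetrizableSpace SigmaPrime :=
  SigmaPrime.isEmbedding_toMap.metrizableSpace

theorem isCompact_circle (r : ℝ) : IsCompact {z : ExtDisk | ‖(z : ℂ)‖ = r} := by
  rcases le_or_gt r 1 with hr | hr
  · convert isCompact_empty
    ext z
    simpa using (hr.trans_lt z.2).ne'
  · rw [Subtype.isCompact_iff]
    convert isCompact_sphere (0 : ℂ) r
    ext z
    simp only [mem_image, mem_sphere_zero_iff_norm, mem_ofPred_eq]
    exact ⟨fun ⟨x, hx, h⟩ => h ▸ hx, fun h => ⟨⟨z, h ▸ hr⟩, h, rfl⟩⟩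

/-- Maximum principle for the ratio of two maps in `Σ'`. -/
theorem SigmaPrime.ratio_le_of_circle (f g : SigmaPrime) {r ε : ℝ} (hr : 1 < r)
    (h : ∀ z : ExtDisk, ‖(z : ℂ)‖ = r → ‖(g.toMap z : ℂ) / f.toMap z - 1‖ ≤ ε)
    (z : ExtDisk) (hz : r ≤ ‖(z : ℂ)‖) : ‖(g.toMap z : ℂ) / f.toMap z - 1‖ ≤ ε := by
  obtain ⟨F, b, hb, hF0, hF, hFne, hfF⟩ := f.exists_disk_coord
  obtain ⟨G, c, hc, hG0, hG, hGne, hgG⟩ := g.exists_disk_coord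
  have hr0 : 0 < r := one_pos.trans hr
  have hratio : ∀ z : ExtDisk, (g.toMap z : ℂ) / f.toMap z - 1 =
      G (z : ℂ)⁻¹ / F (z : ℂ)⁻¹ - 1 := fun z => by
    rw [hgG, hfF, mul_div_mul_left _ _ z.ne_zero]
  have hsub : Metric.closedBall (0 : ℂ) r⁻¹ ⊆ Metric.ball 0 1 :=
    Metric.closedBall_subset_ball (inv_lt_one_of_one_lt₀ hr)
  have hd : DifferentiableOn ℂ (fun w => G w / F w - 1) (Metric.ball 0 1) :=
    (hG.div hF hFne).sub_const 1
  rw [hratio]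
  -- In the coordinate `w = 1/z` the region `|z| ≥ r` together with `∞` is a closed disk, on which
  -- the ratio is holomorphic.
  refine Complex.norm_le_of_forall_mem_frontier_norm_le (U := Metric.ball 0 r⁻¹)
    (f := fun w => G w / F w - 1) Metric.isBounded_ball (hd.diffContOnCl_ball hsub)
    (fun w hw => ?_) ?_
  · rw [frontier_ball _ (inv_pos.2 hr0).ne', mem_sphere_zero_iff_norm] at hw
    have hw' : ‖w⁻¹‖ = r := by rw [norm_inv, hw, inv_inv]
    have := h ⟨w⁻¹, by rw [hw']; exact hr⟩ hw'
    rw [hratio, inv_inv] at this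
    exact this
  · rw [closure_ball _ (inv_pos.2 hr0).ne', mem_closedBall_zero_iff, norm_inv]
    exact inv_anti₀ hr0 hz

/-- Convergence in `Σ'` is uniform convergence of the ratios away from the unit circle. -/
theorem SigmaPrime.tendsto_iff_ratio {ι : Type*} {l : Filter ι} {F : ι → SigmaPrime}
    {f : SigmaPrime} : Tendsto F l (𝓝 f) ↔ ∀ r : ℝ, 1 < r → ∀ ε : ℝ, 0 < ε → ∀ᶠ i in l,
      ∀ z : ExtDisk, r ≤ ‖(z : ℂ)‖ → ‖((F i).toMap z : ℂ) / f.toMap z - 1‖ ≤ ε := by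
  rw [SigmaPrime.isInducing_toMap.tendsto_nhds_iff,
    ContinuousMap.tendsto_iff_forall_isCompact_tendstoUniformlyOn]
  have hratio : ∀ i (z : ExtDisk), ‖((F i).toMap z : ℂ) / f.toMap z - 1‖ =
      dist ((F i).toMap z : ℂ) (f.toMap z) / ‖(f.toMap z : ℂ)‖ := fun i z => by
    rw [dist_eq_norm, ← norm_div, sub_div, div_self (f.toMap z).ne_zero]
  constructor
  · intro h r hr ε hε
    have := Metric.tendstoUniformlyOn_iff.1 (h _ (isCompact_circle r)) ε hε
    filter_upwards [this] with i hi
    -- Closeness on one circle suffices; `|f| > 1` there turns the absolute error into a relative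
    -- one.
    refine f.ratio_le_of_circle (F i) hr fun z hz => ?_
    have h1 := hi z hz
    rw [dist_comm, Subtype.dist_eq] at h1
    rw [hratio, div_le_iff₀ (norm_pos_iff.2 (f.toMap z).ne_zero)]
    exact h1.le.trans (le_mul_of_one_le_right hε.le (f.toMap z).2.le)
  · intro h K hK
    rw [Metric.tendstoUniformlyOn_iff]
    intro ε hε
    rcases K.eq_empty_or_nonempty with rfl | hne
    · simp
    obtain ⟨z₀, -, hz₀⟩ := hK.exists_isMinOn hne
      (f := fun z : ExtDisk => ‖(z : ℂ)‖) (by fun_prop)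
    obtain ⟨z₁, -, hz₁⟩ := hK.exists_isMaxOn hne
      (f := fun z : ExtDisk => ‖(f.toMap z : ℂ)‖) (by fun_prop)
    have hM : 0 < ‖(f.toMap z₁ : ℂ)‖ := norm_pos_iff.2 (f.toMap z₁).ne_zero
    -- `K` lies in `|z| ≥ |z₀|`, and `|f(z₁)|` is the maximum of `|f|` on `K`, converting relative
    -- error into absolute error.
    filter_upwards [h _ z₀.2 (ε / 2 / ‖(f.toMap z₁ : ℂ)‖) (by positivity)] with i hi z hz
    have h1 := hi z (hz₀ hz)
    have h2 : ‖(f.toMap z : ℂ)‖ ≤ ‖(f.toMap z₁ : ℂ)‖ := hz₁ hz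
    rw [hratio, div_le_iff₀ (norm_pos_iff.2 (f.toMap z).ne_zero)] at h1
    rw [dist_comm, Subtype.dist_eq]
    refine h1.trans_lt ?_
    calc ε / 2 / ‖(f.toMap z₁ : ℂ)‖ * ‖(f.toMap z : ℂ)‖
        ≤ ε / 2 / ‖(f.toMap z₁ : ℂ)‖ * ‖(f.toMap z₁ : ℂ)‖ := by gcongr
      _ = ε / 2 := div_mul_cancel₀ _ hM.ne'
      _ < ε := half_lt_self hε

theorem SigmaPrime.continuous_comp : Continuous fun p : SigmaPrime × SigmaPrime => p.1.comp p.2 := by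
  rw [SigmaPrime.isInducing_toMap.continuous_iff]
  exact (SigmaPrime.isInducing_toMap.continuous.comp continuous_fst).compCM
    (SigmaPrime.isInducing_toMap.continuous.comp continuous_snd)

theorem SigmaPrime.continuous_rotate (φ : SigmaPrime) : Continuous φ.rotate := by
  rw [SigmaPrime.isInducing_toMap.continuous_iff]
  refine ContinuousMap.continuous_of_continuous_uncurry _ ?_
  have hrot : Continuous fun p : Angles × ExtDisk => rotPt p.1 p.2 := by
    unfold rotPt
    refine Continuous.subtype_mk ?_ _
    exact (continuous_subtype_val.comp (AddCircle.continuous_toCircle.comp continuous_fst)).mul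
      (continuous_subtype_val.comp continuous_snd)
  exact hrot.comp (continuous_fst.prodMk (φ.toMap.continuous.comp
    (hrot.comp (continuous_fst.neg.prodMk continuous_snd))))

/-- The dilation by `r > 1`. -/
def dilate (r : ℝ) (hr : 1 < r) (z : ExtDisk) : ExtDisk :=
  ⟨r * z, by
    rw [norm_mul, Complex.norm_real, Real.norm_of_nonneg (by positivity)]
    exact one_lt_mul_of_lt_of_le hr z.2.le⟩

theorem norm_dilate (r : ℝ) (hr : 1 < r) (z : ExtDisk) :
    ‖(dilate r hr z : ℂ)‖ = r * ‖(z : ℂ)‖ := by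
  rw [dilate, norm_mul, Complex.norm_real, Real.norm_of_nonneg (by positivity)]

theorem tendsto_dilate (r : ℝ) (hr : 1 < r) : Tendsto (dilate r hr) nearInfty nearInfty := by
  rw [nearInfty, tendsto_comap_iff]
  have h1 : Tendsto (fun z : ExtDisk => ‖(z : ℂ)‖) nearInfty atTop := tendsto_comap
  refine (h1.const_mul_atTop (one_pos.trans hr)).congr fun z => ?_
  rw [Function.comp, norm_dilate]

theorem SigmaPrime.tendsto_ratio (f g : SigmaPrime) :
    ∃ c : ℝ, 0 < c ∧ Tendsto (fun z => (g.toMap z : ℂ) / f.toMap z) nearInfty (𝓝 (c : ℂ)) := by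
  obtain ⟨b, hb, hf⟩ := f.at_infty
  obtain ⟨c, hc, hg⟩ := g.at_infty
  refine ⟨c / b, by positivity, ?_⟩
  push_cast
  refine (hg.div hf (by exact_mod_cast hb.ne')).congr fun z => ?_
  simp only [Pi.div_apply]
  rw [div_div_div_cancel_right₀ z.ne_zero]

/-- Where the ratio of two maps is close to `1`, the ratio of their root transforms is its
principal root. -/
theorem SigmaPrime.koebe_ratio (f g : SigmaPrime) {n : ℕ} (hn : n ≠ 0) {r : ℝ} (hr : 1 < r)
    (h : ∀ z : ExtDisk, r < ‖(z : ℂ)‖ → (g.toMap z : ℂ) / f.toMap z ∈ Complex.slitPlane)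
    (z : ExtDisk) (hz : r < ‖(z : ℂ)‖) :
    ((g.koebe n).toMap z : ℂ) / (f.koebe n).toMap z =
      ((g.toMap (powPt n hn z) : ℂ) / f.toMap (powPt n hn z)) ^ (n : ℂ)⁻¹ := by
  have hr0 : 0 < r := one_pos.trans hr
  -- The dilation parametrizes `|z| > r` by the whole exterior disk, a connected space, as
  -- `root_unique` requires. The principal root is continuous since the ratio avoids the slit.
  have hdil : Continuous (dilate r hr) := by unfold dilate; fun_prop
  have hnorm : ∀ x : ExtDisk, r < ‖(powPt n hn (dilate r hr x) : ℂ)‖ := fun x => by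
    have h1 : r < ‖(dilate r hr x : ℂ)‖ := by
      rw [norm_dilate]; exact lt_mul_of_one_lt_right hr0 x.2
    refine h1.trans_le ?_
    simp only [powPt, norm_pow]
    exact le_self_pow₀ (dilate r hr x).2.le hn
  have hu : Continuous fun x : ExtDisk => (g.toMap (powPt n hn (dilate r hr x)) : ℂ) /
      f.toMap (powPt n hn (dilate r hr x)) := by
    have hp := continuous_powPt hn
    exact Continuous.div (by fun_prop) (by fun_prop) fun x => ExtDisk.ne_zero _
  obtain ⟨c, hc, hlim⟩ := f.tendsto_ratio g
  obtain ⟨d, hd, hlim'⟩ := (f.koebe n).tendsto_ratio (g.koebe n)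
  have hc0 : ((c ^ (n : ℝ)⁻¹ : ℝ) : ℂ) ≠ 0 := by
    exact_mod_cast (Real.rpow_pos_of_pos hc _).ne'
  have key := root_unique (l := nearInfty) hn
    (u := fun x : ExtDisk => ((g.koebe n).toMap (dilate r hr x) : ℂ) /
      (f.koebe n).toMap (dilate r hr x))
    (v := fun x : ExtDisk => ((g.toMap (powPt n hn (dilate r hr x)) : ℂ) /
      f.toMap (powPt n hn (dilate r hr x))) ^ (n : ℂ)⁻¹)
    (Continuous.div (by fun_prop) (by fun_prop) fun x => ExtDisk.ne_zero _)
    (hu.cpow continuous_const fun x => h _ (hnorm x))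
    (fun x => by
      rw [Complex.cpow_ne_zero_iff]
      exact Or.inl (div_ne_zero (ExtDisk.ne_zero _) (ExtDisk.ne_zero _)))
    (fun x => by
      rw [Complex.cpow_nat_inv_pow _ hn, div_pow, koebe_pow' _ hn, koebe_pow' _ hn])
    (c := d / c ^ (n : ℝ)⁻¹) (by positivity) ?_
  · have hz' : 1 < ‖(z : ℂ) / r‖ := by
      rw [norm_div, Complex.norm_real, Real.norm_of_nonneg hr0.le, one_lt_div hr0]
      exact hz
    have h2 : dilate r hr ⟨(z : ℂ) / r, hz'⟩ = z := Subtype.ext (by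
      have : (r : ℂ) ≠ 0 := by exact_mod_cast hr0.ne'
      simp only [dilate]
      field_simp)
    have := congrFun key ⟨(z : ℂ) / r, hz'⟩
    simp only [h2] at this
    exact this
  · rw [Complex.ofReal_div]
    refine (hlim'.comp (tendsto_dilate r hr)).div ?_ hc0
    have h3 := (hlim.comp ((tendsto_powPt hn).comp (tendsto_dilate r hr))).cpow
      (tendsto_const_nhds (x := (n : ℂ)⁻¹)) (Complex.ofReal_mem_slitPlane.2 hc)
    rw [Complex.ofReal_cpow hc.le]
    push_cast
    exact h3

/-- If `g/f` is uniformly close to `1`, then by `koebe_ratio` the quotient of the transforms is a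
principal root of a number close to `1`, hence close to `1`. -/
theorem SigmaPrime.continuous_koebe {n : ℕ} (hn : n ≠ 0) :
    Continuous (SigmaPrime.koebe n) := by
  rw [continuous_iff_continuousAt]
  intro f
  refine SigmaPrime.tendsto_iff_ratio.2 fun r hr ε hε => ?_
  have hcont : ContinuousAt (fun u : ℂ => u ^ (n : ℂ)⁻¹) 1 :=
    continuousAt_id.cpow continuousAt_const Complex.one_mem_slitPlane
  obtain ⟨δ, hδ, h1⟩ := Metric.continuousAt_iff.1 hcont ε hε
  -- A radius below `r` is needed because `koebe_ratio` speaks of a strict inequality. The bound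
  -- `1/2` in the next line keeps the ratio in the right half-plane.
  have hr' : 1 < (1 + r) / 2 := by linarith
  filter_upwards [SigmaPrime.tendsto_iff_ratio.1 tendsto_id ((1 + r) / 2) hr' (min (δ / 2) (1 / 2))
    (by positivity)] with g hg z hz
  rw [f.koebe_ratio g hn hr' (fun z hz => ?_) z (by linarith)]
  · have h2 : ‖(z : ℂ)‖ ≤ ‖(powPt n hn z : ℂ)‖ := by
      simp only [powPt, norm_pow]
      exact le_self_pow₀ z.2.le hn
    have h3 := (hg (powPt n hn z) (by linarith)).trans (min_le_left _ _)
    have h4 := h1 (x := (g.toMap (powPt n hn z) : ℂ) / f.toMap (powPt n hn z))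
      (by rw [dist_eq_norm]; exact h3.trans_lt (half_lt_self hδ))
    rw [Complex.one_cpow, dist_eq_norm] at h4
    exact h4.le
  · have h3 := (hg z hz.le).trans (min_le_right _ _)
    have h4 := (Complex.abs_re_le_norm _).trans h3
    rw [Complex.sub_re, Complex.one_re, abs_le] at h4
    exact Or.inl (by simp only [id] at h4; linarith)

theorem continuous_step (φ : SigmaPrime) {k : ℕ} (hk : k ≠ 0) :
    Continuous fun p : SigmaPrime × Angles => step φ k p.1 p.2 :=
  SigmaPrime.continuous_comp.comp ((φ.continuous_rotate.comp continuous_snd).prodMk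
    ((SigmaPrime.continuous_koebe hk).comp continuous_fst))

theorem continuous_approx (φ : SigmaPrime) {k : ℕ} (hk : k ≠ 0) (n : ℕ) :
    Continuous fun θ : ℕ → Angles => approx φ k θ n := by
  induction n with
  | zero => exact φ.continuous_rotate.comp (continuous_apply 0)
  | succ n ih =>
    exact SigmaPrime.continuous_comp.comp (ih.prodMk ((SigmaPrime.continuous_koebe
      (pow_ne_zero _ hk)).comp (φ.continuous_rotate.comp (continuous_apply (n + 1)))))

/-! ### Hurwitz's theorem and a convergence criterion in `Σ'`. -/

theorem isOpen_one_lt_norm : IsOpen {z : ℂ | 1 < ‖z‖} := isOpen_lt continuous_const continuous_norm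

theorem isPreconnected_one_lt_norm : IsPreconnected {z : ℂ | 1 < ‖z‖} :=
  isPreconnected_iff_preconnectedSpace.2 (inferInstanceAs (PreconnectedSpace ExtDisk))

/-- Hurwitz's theorem: a value that a nonconstant holomorphic function takes at `a` is taken near
`a` by all holomorphic functions close to it. -/
theorem exists_forall_near_mem_image {F : ℂ → ℂ} {U : Set ℂ} (hU : IsOpen U)
    (hF : DifferentiableOn ℂ F U) {a : ℂ} (ha : a ∈ U) (hne : ¬ ∀ᶠ z in 𝓝 a, F z = F a)
    {ρ : ℝ} (hρ : 0 < ρ) :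
    ∃ r, 0 < r ∧ r ≤ ρ ∧ Metric.closedBall a r ⊆ U ∧ ∃ ε > 0, ∀ g : ℂ → ℂ,
      DifferentiableOn ℂ g U → (∀ z ∈ Metric.closedBall a r, ‖g z - F z‖ < ε) →
      F a ∈ g '' Metric.closedBall a r := by
  have hFa : AnalyticAt ℂ F a := hF.analyticAt (hU.mem_nhds ha)
  have h1 := (hFa.eventually_eq_or_eventually_ne analyticAt_const).resolve_left hne
  rw [eventually_nhdsWithin_iff] at h1
  obtain ⟨R, hR, hRsub⟩ := Metric.mem_nhds_iff.1 (h1.and (hU.mem_nhds ha))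
  have hr : 0 < min (R / 2) ρ := by positivity
  have hrR : min (R / 2) ρ < R := (min_le_left _ _).trans_lt (half_lt_self hR)
  generalize hrdef : min (R / 2) ρ = r at hr hrR
  have hcb : Metric.closedBall a r ⊆ Metric.ball a R := Metric.closedBall_subset_ball hrR
  have hcbU : Metric.closedBall a r ⊆ U := fun z hz => (hRsub (hcb hz)).2
  have hFc : ContinuousOn F (Metric.closedBall a r) := hF.continuousOn.mono hcbU
  obtain ⟨x, hx, hmin⟩ := (isCompact_sphere a r).exists_isMinOn
    (NormedSpace.sphere_nonempty.2 hr.le)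
    (f := fun z => ‖F z - F a‖)
    ((hFc.mono Metric.sphere_subset_closedBall).sub continuousOn_const).norm
  have hxa : x ≠ a := Metric.ne_of_mem_sphere hx hr.ne'
  have hm : 0 < ‖F x - F a‖ := norm_pos_iff.2 (sub_ne_zero.2
    ((hRsub (hcb (Metric.sphere_subset_closedBall hx))).1 hxa))
  -- With `m = min |F - F a|` on the sphere and error below `m/4`, one gets `|g - g a| ≥ m/2` there.
  -- The quantitative open mapping theorem then covers the ball of radius `m/4` about `g a`, which
  -- contains `F a`.
  refine ⟨r, hr, hrdef ▸ min_le_right _ _, hcbU, ‖F x - F a‖ / 4, by positivity,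
    fun g hg hclose => ?_⟩
  have haball : a ∈ Metric.closedBall a r := Metric.mem_closedBall_self hr.le
  have hsphere : ∀ z ∈ Metric.sphere a r, ‖F x - F a‖ / 2 ≤ ‖g z - g a‖ := fun z hz => by
    have e1 : ‖F x - F a‖ ≤ ‖F z - F a‖ := hmin hz
    have e2 := hclose z (Metric.sphere_subset_closedBall hz)
    have e3 := hclose a haball
    have e4 : ‖F z - F a‖ ≤ ‖g z - g a‖ + ‖g z - F z‖ + ‖g a - F a‖ := by
      calc ‖F z - F a‖ = ‖(g z - g a) - (g z - F z) + (g a - F a)‖ := by ring_nf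
        _ ≤ ‖(g z - g a) - (g z - F z)‖ + ‖g a - F a‖ := norm_add_le _ _
        _ ≤ _ := by gcongr; exact norm_sub_le _ _
    linarith
  have hgd : DiffContOnCl ℂ g (Metric.ball a r) := hg.diffContOnCl_ball hcbU
  refine hgd.ball_subset_image_closedBall hr hsphere ?_ ?_
  -- If `g` were constant near `a`, it would be constant on the ball of radius `R`, against the
  -- lower bound on the sphere.
  · intro hev
    have hga : AnalyticOnNhd ℂ g (Metric.ball a R) :=
      (hg.mono fun z hz => (hRsub hz).2).analyticOnNhd Metric.isOpen_ball
    have heq := hga.eqOn_of_preconnected_of_eventuallyEq (g := fun _ => g a)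
      (fun z _ => analyticAt_const) (convex_ball a R).isPreconnected (Metric.mem_ball_self hR)
      (hev.mono fun z hz => not_not.1 hz)
    have h2 := hsphere x hx
    rw [heq (hcb (Metric.sphere_subset_closedBall hx)), sub_self, norm_zero] at h2
    linarith
  · rw [Metric.mem_ball, dist_comm, dist_eq_norm]
    have := hclose a haball
    linarith

/-- By the identity theorem local constancy would spread to the whole connected exterior, where `F`
is unbounded. This supplies Hurwitz's hypothesis even for a limit map not yet known to be injective.
-/
theorem not_eventually_eq_of_norm_le {F : ℂ → ℂ} (hF : DifferentiableOn ℂ F {z | 1 < ‖z‖})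
    (hle : ∀ z, 1 < ‖z‖ → ‖z‖ ≤ ‖F z‖) {a : ℂ} (ha : 1 < ‖a‖) :
    ¬ ∀ᶠ z in 𝓝 a, F z = F a := by
  intro h
  have heq := (hF.analyticOnNhd isOpen_one_lt_norm).eqOn_of_preconnected_of_eventuallyEq
    (g := fun _ => F a) (fun z _ => analyticAt_const) isPreconnected_one_lt_norm ha h
  have hn : ‖((‖F a‖ + 2 : ℝ) : ℂ)‖ = ‖F a‖ + 2 := by
    rw [Complex.norm_real, Real.norm_of_nonneg (by positivity)]
  have h1 : 1 < ‖((‖F a‖ + 2 : ℝ) : ℂ)‖ := by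
    rw [hn]; linarith [norm_nonneg (F a)]
  have h2 := hle _ h1
  rw [heq h1, hn] at h2
  linarith

/-- A sequence in `Σ'` with geometrically small increments converges in `Σ'`. -/
theorem SigmaPrime.exists_tendsto_of_geometric (f : ℕ → SigmaPrime)
    (h : ∀ r : ℝ, 1 < r → ∃ A : ℝ, ∀ n, ∀ z : ExtDisk, r ≤ ‖(z : ℂ)‖ →
      dist ((f n).toMap z : ℂ) ((f (n + 1)).toMap z) ≤ A * ‖(z : ℂ)‖ / 2 / 2 ^ n) :
    ∃ g, Tendsto f atTop (𝓝 g) := by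
  have hlimz : ∀ z : ExtDisk, ∃ y : ℂ, Tendsto (fun n => ((f n).toMap z : ℂ)) atTop (𝓝 y) :=
    fun z => by
      obtain ⟨A, hA⟩ := h _ z.2
      exact cauchySeq_tendsto_of_complete (cauchySeq_of_le_geometric_two fun n => hA n z le_rfl)
  choose F hF using hlimz
  have hdist : ∀ r : ℝ, 1 < r → ∃ A : ℝ, 0 ≤ A ∧ ∀ n, ∀ z : ExtDisk, r ≤ ‖(z : ℂ)‖ →
      dist ((f n).toMap z : ℂ) (F z) ≤ A * ‖(z : ℂ)‖ / 2 ^ n := by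
    intro r hr
    obtain ⟨A, hA⟩ := h r hr
    refine ⟨|A|, abs_nonneg A, fun n z hz => ?_⟩
    refine (dist_le_of_le_geometric_two_of_tendsto (fun n => hA n z hz) (hF z) n).trans ?_
    gcongr
    exact le_abs_self A
  have hnorm : ∀ z : ExtDisk, ‖(z : ℂ)‖ ≤ ‖F z‖ := fun z =>
    ge_of_tendsto' (hF z).norm fun n => (f n).norm_le z
  choose H hHd hHf using fun n => (f n).holomorphic
  let E : ℂ → ℂ := fun z => if hz : 1 < ‖z‖ then F ⟨z, hz⟩ else 0
  have hE : ∀ z : ExtDisk, E z = F z := fun z => dif_pos z.2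
  have hpow : ∀ A : ℝ, Tendsto (fun n : ℕ => A / 2 ^ n) atTop (𝓝 0) := fun A =>
    tendsto_const_nhds.div_atTop (tendsto_pow_atTop_atTop_of_one_lt one_lt_two)
  have hunif : TendstoLocallyUniformlyOn H E atTop {z | 1 < ‖z‖} := by
    rw [Metric.tendstoLocallyUniformlyOn_iff]
    intro ε hε x hx
    obtain ⟨A, hA0, hA⟩ := hdist ((1 + ‖x‖) / 2) (by have : 1 < ‖x‖ := hx; linarith)
    -- The lower bound on `‖y‖` gives a common constant `A`; the upper bound controls the factor
    -- `‖y‖` in the error.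
    refine ⟨{y | (1 + ‖x‖) / 2 < ‖y‖ ∧ ‖y‖ < ‖x‖ + 1}, mem_nhdsWithin_of_mem_nhds
      (((isOpen_lt continuous_const continuous_norm).inter
        (isOpen_lt continuous_norm continuous_const)).mem_nhds
        ⟨by have : 1 < ‖x‖ := hx; change (1 + ‖x‖) / 2 < ‖x‖; linarith, lt_add_one ‖x‖⟩), ?_⟩
    filter_upwards [(hpow (A * (‖x‖ + 1))).eventually_lt_const hε] with n hn y hy
    have hy1 : 1 < ‖y‖ := by have : 1 < ‖x‖ := hx; linarith [hy.1]
    have h1 := hA n ⟨y, hy1⟩ hy.1.le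
    rw [← hHf, ← hE, dist_comm] at h1
    refine (h1.trans ?_).trans_lt hn
    gcongr
    exact hy.2.le
  have hEd : DifferentiableOn ℂ E {z | 1 < ‖z‖} :=
    hunif.differentiableOn (Eventually.of_forall hHd) isOpen_one_lt_norm
  have hEnorm : ∀ z, 1 < ‖z‖ → ‖z‖ ≤ ‖E z‖ := fun z hz => by
    rw [hE ⟨z, hz⟩]; exact hnorm ⟨z, hz⟩
  have hEcont : Continuous fun z : ExtDisk => F z :=
    (hEd.continuousOn.comp_continuous continuous_subtype_val fun z => z.2).congr hE
  have hinj : Function.Injective F := by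
    intro a b hab
    by_contra hne
    have hne' : (a : ℂ) ≠ b := fun h => hne (Subtype.ext h)
    -- Balls of radius at most a third of the distance are disjoint. By Hurwitz, `f n` takes the
    -- common value in both for large `n`, contradicting its injectivity.
    have key : ∀ c : ExtDisk, ∃ r, 0 < r ∧ r ≤ dist (a : ℂ) b / 3 ∧
        Metric.closedBall (c : ℂ) r ⊆ {z | 1 < ‖z‖} ∧ ∀ᶠ n in atTop, E c ∈ H n '' Metric.closedBall (c : ℂ) r := fun c => by
      obtain ⟨r, hr, hrρ, hsub, ε, hε, hg⟩ := exists_forall_near_mem_image isOpen_one_lt_norm hEd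
        c.2 (not_eventually_eq_of_norm_le hEd hEnorm c.2)
        (div_pos (dist_pos.2 hne') three_pos)
      refine ⟨r, hr, hrρ, hsub, ?_⟩
      have := (tendstoLocallyUniformlyOn_iff_forall_isCompact isOpen_one_lt_norm).1 hunif _ hsub
        (isCompact_closedBall _ _)
      filter_upwards [Metric.tendstoUniformlyOn_iff.1 this ε hε] with n hn
      refine hg _ (hHd n) fun z hz => ?_
      rw [← dist_eq_norm, dist_comm]
      exact hn z hz
    obtain ⟨r₁, hr₁, hr₁', hs₁, h₁⟩ := key a
    obtain ⟨r₂, hr₂, hr₂', hs₂, h₂⟩ := key b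
    obtain ⟨n, ⟨z, hz, hza⟩, w, hw, hwb⟩ := (h₁.and h₂).exists
    have hzw : z = w := by
      refine congrArg Subtype.val ((f n).injective (a₁ := ⟨z, hs₁ hz⟩) (a₂ := ⟨w, hs₂ hw⟩) ?_)
      apply Subtype.ext
      rw [← hHf, ← hHf, hza, hwb, hE, hE, hab]
    rw [← hzw, Metric.mem_closedBall] at hw
    rw [Metric.mem_closedBall, dist_comm] at hz
    have := dist_triangle (a : ℂ) z b
    have := dist_pos.2 hne'
    linarith
  choose β hβ0 hβ using fun n => (f n).at_infty
  obtain ⟨A, hA⟩ := h 2 one_lt_two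
  obtain ⟨A', hA'0, hA'⟩ := hdist 2 one_lt_two
  have hfar : ∀ᶠ z : ExtDisk in nearInfty, 2 ≤ ‖(z : ℂ)‖ :=
    tendsto_comap.eventually (eventually_ge_atTop 2)
  have hdiv : ∀ (x y : ℂ) (z : ExtDisk), dist (x / (z : ℂ)) (y / z) = dist x y / ‖(z : ℂ)‖ :=
    fun x y z => by rw [dist_eq_norm, dist_eq_norm, ← sub_div, norm_div]
  have hβd : ∀ n, dist (β n) (β (n + 1)) ≤ A / 2 / 2 ^ n := fun n => by
    have h1 := (hβ n).dist (hβ (n + 1))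
    rw [Complex.dist_eq, ← Complex.ofReal_sub, Complex.norm_real, ← dist_eq_norm] at h1
    refine le_of_tendsto h1 ?_
    filter_upwards [hfar] with z hz
    rw [hdiv, div_le_iff₀ (norm_pos_iff.2 z.ne_zero)]
    exact (hA n z hz).trans_eq (by ring)
  obtain ⟨b, hb⟩ := cauchySeq_tendsto_of_complete (cauchySeq_of_le_geometric_two hβd)
  -- This keeps the limit `b` of the derivatives at infinity positive.
  have hβ1 : ∀ n, 1 ≤ β n := fun n => by
    have h1 := (hβ n).norm
    rw [Complex.norm_real, Real.norm_of_nonneg (hβ0 n).le] at h1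
    refine ge_of_tendsto' h1 fun z => ?_
    rw [norm_div, one_le_div (norm_pos_iff.2 z.ne_zero)]
    exact (f n).norm_le z
  have hb1 : 1 ≤ b := ge_of_tendsto' hb hβ1
  have hFlim : Tendsto (fun z : ExtDisk => F z / (z : ℂ)) nearInfty (𝓝 (b : ℂ)) := by
    -- Uniform convergence of `f_n(z)/z` near infinity allows the two limits to be exchanged.
    refine TendstoUniformlyOnFilter.tendsto_of_eventually_tendsto
      (F := fun n (z : ExtDisk) => ((f n).toMap z : ℂ) / (z : ℂ)) (p := atTop) ?_
      (Eventually.of_forall hβ) ((Complex.continuous_ofReal.tendsto b).comp hb)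
    rw [Metric.tendstoUniformlyOnFilter_iff]
    intro ε hε
    refine (((hpow A').eventually_lt_const hε).prod_mk hfar).mono fun p hp => ?_
    rw [hdiv, dist_comm]
    refine lt_of_le_of_lt ?_ hp.1
    rw [div_le_iff₀ (norm_pos_iff.2 p.2.ne_zero)]
    exact (hA' p.1 p.2 hp.2).trans_eq (by ring)
  refine ⟨⟨⟨fun z => ⟨F z, z.2.trans_le (hnorm z)⟩, hEcont.subtype_mk _⟩,
    fun a b hab => hinj (congrArg Subtype.val hab), ⟨E, hEd, hE⟩, b, one_pos.trans_le hb1, hFlim⟩,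
    SigmaPrime.tendsto_iff_ratio.2 fun r hr ε hε => ?_⟩
  obtain ⟨C, hC0, hC⟩ := hdist r hr
  filter_upwards [(hpow C).eventually_lt_const hε] with n hn z hz
  have hz0 : 0 < ‖(z : ℂ)‖ := norm_pos_iff.2 z.ne_zero
  have hF0 : F z ≠ 0 := norm_pos_iff.1 (hz0.trans_le (hnorm z))
  simp only [ContinuousMap.coe_mk]
  rw [← div_self hF0, ← sub_div, norm_div, ← dist_eq_norm, div_le_iff₀ (norm_pos_iff.2 hF0)]
  calc dist ((f n).toMap z : ℂ) (F z) ≤ C * ‖(z : ℂ)‖ / 2 ^ n := hC n z hz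
    _ = C / 2 ^ n * ‖(z : ℂ)‖ := by ring
    _ ≤ ε * ‖F z‖ := by gcongr; exact hnorm z

/-! ### Convergence of the approximations and self-similarity of the snowflake. -/

/-- Root transforms of rotations of `φ` are uniformly close to the identity. -/
theorem SigmaPrime.exists_koebe_rotate_bound (φ : SigmaPrime) {r : ℝ} (hr : 1 < r) :
    ∃ C : ℝ, 0 ≤ C ∧ ∀ n : ℕ, n ≠ 0 → ∀ (θ : Angles) (z : ExtDisk), r ≤ ‖(z : ℂ)‖ →
      ‖(((φ.rotate θ).koebe n).toMap z : ℂ)‖ ≤ ‖(z : ℂ)‖ * Real.exp (C / n) ∧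
      ‖(((φ.rotate θ).koebe n).toMap z : ℂ) - z‖ ≤ ‖(z : ℂ)‖ * (C * Real.exp C / n) := by
  obtain ⟨L, β, hL0, hL, hφL⟩ := φ.exists_log
  have hr0 : 0 < r := one_pos.trans hr
  have hsub : Metric.closedBall (0 : ℂ) r⁻¹ ⊆ Metric.ball 0 1 :=
    Metric.closedBall_subset_ball (inv_lt_one_of_one_lt₀ hr)
  -- `C` bounds `|L|` on a disk about `0`. Rotating `φ` only rotates the argument of `L`, so `C`
  -- does not depend on `θ`.
  obtain ⟨C, hC⟩ := (isCompact_closedBall (0 : ℂ) r⁻¹).exists_bound_of_continuousOn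
    (hL.continuousOn.mono hsub)
  have hC0 : 0 ≤ C := (norm_nonneg _).trans
    (hC 0 (Metric.mem_closedBall_self (inv_pos.2 hr0).le))
  refine ⟨C, hC0, fun n hn θ z hz => ?_⟩
  have hn1 : (1 : ℝ) ≤ n := by exact_mod_cast Nat.one_le_iff_ne_zero.2 hn
  have hθ : (AddCircle.toCircle θ : ℂ) ≠ 0 := Circle.coe_ne_zero _
  have hformula := (φ.rotate θ).koebe_apply_of_log hn
    (L := fun w => L (AddCircle.toCircle θ * w)) (β := β) (by simp [hL0])
    (hL.continuousOn.comp (by fun_prop) fun w hw => by simpa [Circle.norm_coe] using hw)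
    (fun z => by
      have h1 : ((φ.rotate θ).toMap z : ℂ) =
          (AddCircle.toCircle θ : ℂ) * φ.toMap (rotPt (-θ) z) := rfl
      rw [h1, hφL]
      simp only [rotPt, AddCircle.toCircle_neg, Circle.coe_inv, mul_inv, inv_inv]
      field_simp) z
  have hx : ‖L (AddCircle.toCircle θ * ((z : ℂ) ^ n)⁻¹) / n‖ ≤ C / n := by
    rw [norm_div, Complex.norm_natCast]
    gcongr
    refine hC _ ?_
    rw [mem_closedBall_zero_iff, norm_mul, Circle.norm_coe, one_mul, norm_inv, norm_pow]
    exact inv_anti₀ hr0 (hz.trans (le_self_pow₀ z.2.le hn))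
  rw [hformula]
  generalize L (AddCircle.toCircle θ * ((z : ℂ) ^ n)⁻¹) / n = x at hx
  constructor
  · rw [norm_mul]
    gcongr
    exact (Complex.norm_exp_le_exp_norm x).trans (Real.exp_le_exp.2 hx)
  · have h1 := Complex.norm_exp_sub_sum_le_norm_mul_exp x 1
    simp only [Finset.sum_range_one, pow_zero, Nat.factorial_zero, Nat.cast_one, div_one,
      pow_one] at h1
    rw [← mul_sub_one, norm_mul]
    gcongr
    refine h1.trans ?_
    calc ‖x‖ * Real.exp ‖x‖ ≤ C / n * Real.exp C := by
          gcongr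
          exact hx.trans (div_le_self hC0 hn1)
      _ = C * Real.exp C / n := by ring

/-- Maps of linear growth are Lipschitz away from the unit circle. -/
theorem SigmaPrime.norm_sub_le_of_growth (f : SigmaPrime) {r M : ℝ} (hr : 1 < r) (hM : 0 ≤ M)
    (hf : ∀ z : ExtDisk, (1 + r) / 2 ≤ ‖(z : ℂ)‖ → ‖(f.toMap z : ℂ)‖ ≤ M * ‖(z : ℂ)‖)
    (y z : ExtDisk) (hy : r ≤ ‖(y : ℂ)‖) (hz : r ≤ ‖(z : ℂ)‖) :
    ‖(f.toMap y : ℂ) - f.toMap z‖ ≤ 6 * M * r / (r - 1) * ‖(y : ℂ) - z‖ := by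
  obtain ⟨F, hF, hFf⟩ := f.holomorphic
  have hr1 : 0 < r - 1 := by linarith
  have hr0 : 0 < r := by linarith
  have hz0 : 0 < ‖(z : ℂ)‖ := norm_pos_iff.2 z.ne_zero
  -- This radius keeps the ball about `z` inside `|ζ| ≥ (1 + r)/2` and `|ζ| ≤ 3|z|/2`, where the
  -- growth bound holds. There `|f ζ - f z| ≤ 3M|z|`, and Schwarz's lemma gives the constant
  -- `3M|z|/R`.
  set R : ℝ := (r - 1) / (2 * r) * ‖(z : ℂ)‖ with hRdef
  have hR : 0 < R := by positivity
  have hs : (r - 1) / (2 * r) ≤ 1 / 2 := by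
    rw [div_le_div_iff₀ (by positivity) two_pos]; linarith
  have hRz : R ≤ 1 / 2 * ‖(z : ℂ)‖ := mul_le_mul_of_nonneg_right hs hz0.le
  have hconst : 3 * M * ‖(z : ℂ)‖ / R = 6 * M * r / (r - 1) := by
    rw [hRdef]; field_simp; ring
  rcases lt_or_ge ‖(y : ℂ) - z‖ R with hlt | hge
  · have hball : ∀ ζ ∈ Metric.ball (z : ℂ) R,
        (1 + r) / 2 ≤ ‖ζ‖ ∧ ‖ζ‖ ≤ 3 / 2 * ‖(z : ℂ)‖ := fun ζ hζ => by
      rw [mem_ball_iff_norm] at hζ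
      have h1 : ‖(z : ℂ)‖ ≤ ‖ζ‖ + ‖ζ - z‖ := by
        simpa using norm_sub_le ζ (ζ - z)
      have h2 : ‖ζ‖ ≤ ‖(z : ℂ)‖ + ‖ζ - z‖ := by
        simpa using norm_add_le (z : ℂ) (ζ - z)
      have h3 : ‖(z : ℂ)‖ - R = (r + 1) / (2 * r) * ‖(z : ℂ)‖ := by
        rw [hRdef]; field_simp; ring
      have h4 : (1 + r) / 2 ≤ (r + 1) / (2 * r) * ‖(z : ℂ)‖ := by
        calc (1 + r) / 2 = (r + 1) / (2 * r) * r := by field_simp; ring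
          _ ≤ _ := by gcongr
      constructor <;> linarith
    have hsub : Metric.ball (z : ℂ) R ⊆ {z | 1 < ‖z‖} := fun ζ hζ => by
      have := (hball ζ hζ).1
      change 1 < ‖ζ‖
      linarith
    have hfz := hf z (by linarith)
    have := Complex.dist_le_div_mul_dist_of_mapsTo_ball (R₂ := 3 * M * ‖(z : ℂ)‖) (hF.mono hsub)
      (fun ζ hζ => ?_) (mem_ball_iff_norm.2 hlt)
    · rw [hFf, hFf, dist_eq_norm, dist_eq_norm, hconst] at this
      exact this
    · have h1 := hf ⟨ζ, hsub hζ⟩ (hball ζ hζ).1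
      rw [mem_closedBall_iff_norm, hFf, hFf ⟨ζ, hsub hζ⟩]
      refine (norm_sub_le _ _).trans ?_
      have h2 : M * ‖ζ‖ ≤ M * (3 / 2 * ‖(z : ℂ)‖) := by
        gcongr; exact (hball ζ hζ).2
      have h3 : 0 ≤ M * ‖(z : ℂ)‖ := by positivity
      simp only at h1
      linarith
  -- For points at distance at least `R` the growth bound and the triangle inequality suffice.
  · have h1 : ‖(y : ℂ)‖ ≤ ‖(z : ℂ)‖ + ‖(y : ℂ) - z‖ := by
      simpa using norm_add_le (z : ℂ) (y - z)
    have h2 := hf y (by linarith)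
    have h3 := hf z (by linarith)
    have h4 : M * ‖(y : ℂ)‖ ≤ M * (‖(z : ℂ)‖ + ‖(y : ℂ) - z‖) := by gcongr
    have h5 : 3 * M * ‖(z : ℂ)‖ ≤ 6 * M * r / (r - 1) * ‖(y : ℂ) - z‖ := by
      calc 3 * M * ‖(z : ℂ)‖ = 6 * M * r / (r - 1) * R := by
            rw [← hconst, div_mul_cancel₀ _ hR.ne']
        _ ≤ _ := by gcongr
    have h6 : 3 * M ≤ 6 * M * r / (r - 1) / 2 := by
      rw [le_div_iff₀ two_pos, le_div_iff₀ hr1]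
      nlinarith
    have h7 : 3 * M * ‖(y : ℂ) - z‖ ≤ 6 * M * r / (r - 1) / 2 * ‖(y : ℂ) - z‖ := by gcongr
    have h8 : 0 ≤ M * ‖(z : ℂ)‖ := by positivity
    refine (norm_sub_le _ _).trans ?_
    linarith

/-- The `n`-th factor multiplies the growth constant by at most `exp(C/2^n)`, and these exponents
have sum at most `2C`. -/
theorem exists_approx_growth (φ : SigmaPrime) {k : ℕ} (hk : 2 ≤ k) {r : ℝ} (hr : 1 < r) :
    ∃ M : ℝ, 0 ≤ M ∧ ∀ (θ : ℕ → Angles) (n : ℕ) (z : ExtDisk), r ≤ ‖(z : ℂ)‖ →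
      ‖((approx φ k θ n).toMap z : ℂ)‖ ≤ M * ‖(z : ℂ)‖ := by
  obtain ⟨C, hC0, hC⟩ := φ.exists_koebe_rotate_bound hr
  refine ⟨Real.exp (C * 2), by positivity, fun θ n z hz => ?_⟩
  -- `2 - (1/2)^n` is the partial sum `1 + 1/2 + … + 1/2^n`.
  have key : ∀ (n : ℕ) (z : ExtDisk), r ≤ ‖(z : ℂ)‖ →
      ‖((approx φ k θ n).toMap z : ℂ)‖ ≤ Real.exp (C * (2 - (1 / 2) ^ n)) * ‖(z : ℂ)‖ := by
    intro n
    induction n with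
    | zero =>
      intro z hz
      have := (hC 1 one_ne_zero (θ 0) z hz).1
      rw [SigmaPrime.koebe_one] at this
      rw [approx, mul_comm]
      refine this.trans_eq ?_
      norm_num
    | succ n ih =>
      intro z hz
      set h := (φ.rotate (θ (n + 1))).koebe (k ^ (n + 1))
      have h1 : ‖(h.toMap z : ℂ)‖ ≤ ‖(z : ℂ)‖ * Real.exp (C / (k ^ (n + 1) : ℕ)) :=
        (hC (k ^ (n + 1)) (pow_ne_zero _ (by omega)) (θ (n + 1)) z hz).1
      have h2 : C / (k ^ (n + 1) : ℕ) ≤ C * (1 / 2) ^ (n + 1) := by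
        rw [div_eq_mul_inv, one_div, inv_pow]
        push_cast
        gcongr
        exact_mod_cast hk
      calc ‖((approx φ k θ n).toMap (h.toMap z) : ℂ)‖
          ≤ Real.exp (C * (2 - (1 / 2) ^ n)) * ‖(h.toMap z : ℂ)‖ :=
            ih _ (hz.trans (h.norm_le z))
        _ ≤ Real.exp (C * (2 - (1 / 2) ^ n)) *
            (‖(z : ℂ)‖ * Real.exp (C * (1 / 2) ^ (n + 1))) := by
            gcongr
            exact h1.trans (by gcongr)
        _ = Real.exp (C * (2 - (1 / 2) ^ (n + 1))) * ‖(z : ℂ)‖ := by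
            rw [mul_comm ‖(z : ℂ)‖, ← mul_assoc, ← Real.exp_add]
            congr 2
            ring
  refine (key n z hz).trans ?_
  gcongr
  simp

/-- `f_{n+1} = f_n ∘ h` with `h` within `O(|z|/k^(n+1))` of the identity, and the `f_n` share a
Lipschitz constant on `|z| ≥ r`. Existence of the limit gives `limUnder` its meaning. -/
theorem tendsto_approx (φ : SigmaPrime) {k : ℕ} (hk : 2 ≤ k) (θ : ℕ → Angles) :
    Tendsto (approx φ k θ) atTop (𝓝 (snowflake φ k θ)) := by
  refine tendsto_nhds_limUnder (SigmaPrime.exists_tendsto_of_geometric _ fun r hr => ?_)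
  obtain ⟨C, hC0, hC⟩ := φ.exists_koebe_rotate_bound hr
  -- The Lipschitz bound on `|z| ≥ r` needs growth on the larger region `|z| ≥ (1 + r)/2`.
  obtain ⟨M, hM0, hM⟩ := exists_approx_growth φ hk (r := (1 + r) / 2) (by linarith)
  have hr1 : 0 < r - 1 := by linarith
  refine ⟨6 * M * r / (r - 1) * (C * Real.exp C), fun n z hz => ?_⟩
  set h := (φ.rotate (θ (n + 1))).koebe (k ^ (n + 1))
  have h1 : ‖(h.toMap z : ℂ) - z‖ ≤ ‖(z : ℂ)‖ * (C * Real.exp C / (k ^ (n + 1) : ℕ)) :=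
    (hC (k ^ (n + 1)) (pow_ne_zero _ (by omega)) (θ (n + 1)) z hz).2
  have h2 : C * Real.exp C / (k ^ (n + 1) : ℕ) ≤ C * Real.exp C / 2 ^ (n + 1) := by
    push_cast
    gcongr
    exact_mod_cast hk
  rw [dist_comm, dist_eq_norm]
  calc ‖((approx φ k θ n).toMap (h.toMap z) : ℂ) - (approx φ k θ n).toMap z‖
      ≤ 6 * M * r / (r - 1) * ‖(h.toMap z : ℂ) - z‖ :=
        SigmaPrime.norm_sub_le_of_growth _ hr hM0 (hM θ n) _ _ (hz.trans (h.norm_le z)) hz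
    _ ≤ 6 * M * r / (r - 1) * (‖(z : ℂ)‖ * (C * Real.exp C / 2 ^ (n + 1))) := by
        gcongr
        exact h1.trans (by gcongr)
    _ = _ := by
        rw [pow_succ]; field_simp

theorem snowflake_eq_step (φ : SigmaPrime) {k : ℕ} (hk : 2 ≤ k) (θ : ℕ → Angles) :
    snowflake φ k θ = step φ k (snowflake φ k fun i => θ (i + 1)) (θ 0) := by
  have hk0 : k ≠ 0 := by omega
  have hcont : Continuous fun f => step φ k f (θ 0) :=
    (continuous_step φ hk0).comp (continuous_id.prodMk continuous_const)
  have h1 := (hcont.tendsto _).comp (tendsto_approx φ hk fun i => θ (i + 1))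
  have h2 := (tendsto_approx φ hk θ).comp (tendsto_add_atTop_nat 1)
  refine tendsto_nhds_unique h2 (h1.congr fun n => ?_)
  exact (approx_succ φ hk0 θ n).symm

theorem measurable_snowflake (φ : SigmaPrime) {k : ℕ} (hk : 2 ≤ k) :
    Measurable (snowflake φ k) :=
  measurable_of_tendsto_metrizable (fun n => (continuous_approx φ (by omega) n).measurable)
    (tendsto_pi_nhds.2 fun θ => tendsto_approx φ hk θ)

/-! ### Measurability of inversion, and inverses of the transformed maps. -/

/-- By Hurwitz, if `f x = z` with `x ∈ B`, every map close to `f` on a small ball about `x` takes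
the value `z` inside that ball. -/
theorem SigmaPrime.isOpen_setOf_mem_image (z : ExtDisk) {B : Set ExtDisk} (hB : IsOpen B) :
    IsOpen {f : SigmaPrime | z ∈ f.toMap '' B} := by
  rw [isOpen_iff_mem_nhds]
  rintro f ⟨x, hx, rfl⟩
  obtain ⟨F, hF, hFf⟩ := f.holomorphic
  have hB' : IsOpen (Subtype.val '' B : Set ℂ) := isOpen_one_lt_norm.isOpenMap_subtype_val B hB
  obtain ⟨ρ, hρ, hρB⟩ := Metric.isOpen_iff.1 hB' x ⟨x, hx, rfl⟩
  obtain ⟨r, hr, hrρ, hsub, ε, hε, hg⟩ := exists_forall_near_mem_image isOpen_one_lt_norm hF x.2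
    (not_eventually_eq_of_norm_le hF (fun w hw => by
      rw [hFf ⟨w, hw⟩]; exact f.norm_le ⟨w, hw⟩) x.2) (half_pos hρ)
  have hK : IsCompact (Subtype.val ⁻¹' Metric.closedBall (x : ℂ) r : Set ExtDisk) := by
    rw [Subtype.isCompact_iff]
    convert isCompact_closedBall (x : ℂ) r
    exact image_preimage_eq_of_subset fun w hw => ⟨⟨w, hsub hw⟩, rfl⟩
  have h1 := ContinuousMap.tendsto_iff_forall_isCompact_tendstoUniformlyOn.1
    (SigmaPrime.isInducing_toMap.continuous.tendsto f) _ hK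
  filter_upwards [Metric.tendstoUniformlyOn_iff.1 h1 ε hε] with g hgf
  obtain ⟨G, hG, hGg⟩ := g.holomorphic
  obtain ⟨w, hw, hwx⟩ := hg G hG fun w hw => by
    have := hgf ⟨w, hsub hw⟩ hw
    rwa [dist_comm, Subtype.dist_eq, dist_eq_norm, ← hGg, ← hFf] at this
  refine ⟨⟨w, hsub hw⟩, ?_, ?_⟩
  · obtain ⟨y, hy, hyw⟩ := hρB (Metric.closedBall_subset_ball
      (hrρ.trans_lt (half_lt_self hρ)) hw)
    rwa [show (⟨w, hsub hw⟩ : ExtDisk) = y from Subtype.ext hyw.symm]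
  · apply Subtype.ext
    rw [← hGg, hwx, hFf]

theorem SigmaPrime.measurableSet_setOf_mem_image (z : ExtDisk) {B : Set ExtDisk}
    (hB : MeasurableSet B) : MeasurableSet {f : SigmaPrime | z ∈ f.toMap '' B} := by
  induction B, hB using MeasurableSet.induction_on_open with
  | isOpen U hU => exact (SigmaPrime.isOpen_setOf_mem_image z hU).measurableSet
  | compl t ht ih =>
    have : {f : SigmaPrime | z ∈ f.toMap '' tᶜ} =
        {f : SigmaPrime | z ∈ f.toMap '' univ} \ {f : SigmaPrime | z ∈ f.toMap '' t} := by
      ext f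
      change z ∈ f.toMap '' tᶜ ↔ z ∈ f.toMap '' univ ∧ z ∉ f.toMap '' t
      -- Injectivity gives `f(tᶜ) = f(univ) \ f(t)`; the range must appear because `z` may lie
      -- outside it.
      rw [compl_eq_univ_sdiff, image_sdiff f.injective]
      rfl
    rw [this]
    exact (SigmaPrime.isOpen_setOf_mem_image z isOpen_univ).measurableSet.diff ih
  | iUnion t hd ht ih =>
    have : {f : SigmaPrime | z ∈ f.toMap '' ⋃ i, t i} =
        ⋃ i, {f : SigmaPrime | z ∈ f.toMap '' t i} := by
      ext f
      change z ∈ f.toMap '' (⋃ i, t i) ↔ _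
      rw [image_iUnion, mem_iUnion, mem_iUnion]
      rfl
    rw [this]
    exact MeasurableSet.iUnion ih

theorem SigmaPrime.measurable_inv : Measurable SigmaPrime.inv := by
  refine measurable_generateFrom ?_
  rintro _ ⟨z, B, hB, rfl⟩
  convert SigmaPrime.measurableSet_setOf_mem_image z hB using 1
  ext f
  change (∃ x ∈ f.inv z, x ∈ B) ↔ ∃ x, x ∈ B ∧ f.toMap x = z
  simp only [SigmaPrime.mem_inv, and_comm]

theorem SigmaPrime.rotatePartial_inv (φ : SigmaPrime) (θ : Angles) :
    rotatePartial θ φ.inv = (φ.rotate θ).inv := by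
  have h : ∀ z, rotPt θ (rotPt (-θ) z) = z := fun z => by
    simpa using rotPt_neg_rotPt (-θ) z
  refine PFun.ext fun z w => ?_
  rw [rotatePartial, Part.mem_map_iff, SigmaPrime.mem_inv]
  simp only [SigmaPrime.mem_inv]
  change _ ↔ rotPt θ (φ.toMap (rotPt (-θ) w)) = z
  constructor
  · rintro ⟨x, hx, rfl⟩
    rw [rotPt_neg_rotPt, hx, h]
  · rintro rfl
    exact ⟨rotPt (-θ) w, (rotPt_neg_rotPt _ _).symm, h w⟩

theorem SigmaPrime.inv_comp (f g : SigmaPrime) : (f.comp g).inv = g.inv.comp f.inv := by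
  refine PFun.ext fun z w => ?_
  refine ((f.comp g).mem_inv z w).trans (Iff.trans ?_ Part.mem_bind_iff.symm)
  simp only [SigmaPrime.mem_inv]
  exact ⟨fun h => ⟨g.toMap w, h, rfl⟩, fun ⟨a, ha, hw⟩ => by rw [← ha, ← hw]; rfl⟩

/-- This transfers the identity in law from maps to their inverses, with equality of domains
included. -/
theorem inv_step (φ : SigmaPrime) {k : ℕ} (hk : k ≠ 0) (f : SigmaPrime) (θ : Angles) :
    (step φ k f θ).inv = (koebePartial k f.inv).comp (rotatePartial θ φ.inv) := by
  rw [koebePartial_inv f hk, SigmaPrime.rotatePartial_inv, step, SigmaPrime.inv_comp]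

/-! ### Invariance of the law. -/

/-- Prepending an independent term to an i.i.d. sequence gives an i.i.d. sequence. -/
theorem measurePreserving_cons {X : Type*} [MeasurableSpace X] (ν : Measure X)
    [IsProbabilityMeasure ν] :
    MeasurePreserving (fun p : (ℕ → X) × X => fun n : ℕ => Nat.casesOn n p.2 p.1)
      ((Measure.infinitePi fun _ : ℕ => ν).prod ν) (Measure.infinitePi fun _ : ℕ => ν) := by
  have hmeas : Measurable (fun p : (ℕ → X) × X => fun n : ℕ => (Nat.casesOn n p.2 p.1 : X)) := by
    refine measurable_pi_iff.2 fun n => ?_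
    cases n with
    | zero => exact measurable_snd
    | succ n => exact (measurable_pi_apply n).comp measurable_fst
  refine ⟨hmeas, Measure.eq_infinitePi _ fun s t ht => ?_⟩
  classical
  obtain ⟨N, hN⟩ := s.bddAbove
  have hsN : s ⊆ Finset.range (N + 1) := fun i hi => Finset.mem_range.2 (Nat.lt_succ_of_le (hN hi))
  -- Padding with `univ` replaces `s` by an initial segment, so that the preimage of the cylinder
  -- splits into a shifted cylinder times the factor at index `0`.
  set u : ℕ → Set X := fun i => if i ∈ s then t i else univ with hu
  have hum : ∀ i, MeasurableSet (u i) := fun i => by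
    simp only [hu]; split_ifs; exacts [ht i, MeasurableSet.univ]
  have hpi : Set.pi (s : Set ℕ) t = Set.pi (Finset.range (N + 1) : Set ℕ) u := by
    ext x
    simp only [Set.mem_pi, hu, Finset.mem_coe]
    refine ⟨fun h i _ => ?_, fun h i hi => ?_⟩
    · split_ifs with his
      exacts [h i his, trivial]
    · have := h i (hsN hi)
      rwa [if_pos hi] at this
  have hprod : ∏ i ∈ s, ν (t i) = ∏ i ∈ Finset.range (N + 1), ν (u i) := by
    rw [← Finset.prod_subset hsN fun i _ hi => by simp [hu, hi]]
    exact Finset.prod_congr rfl fun i hi => by simp [hu, hi]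
  rw [hprod, hpi, Measure.map_apply hmeas
    (MeasurableSet.pi (Finset.countable_toSet _) fun i _ => hum i)]
  have hpre : (fun p : (ℕ → X) × X => fun n : ℕ => (Nat.casesOn n p.2 p.1 : X)) ⁻¹'
      Set.pi (Finset.range (N + 1) : Set ℕ) u =
      (Set.pi (Finset.range N : Set ℕ) fun i => u (i + 1)) ×ˢ u 0 := by
    ext ⟨x, a⟩
    simp only [mem_preimage, Set.mem_pi, mem_prod, Finset.mem_coe, Finset.mem_range]
    refine ⟨fun h => ⟨fun i hi => h (i + 1) (by omega), h 0 (by omega)⟩, fun h i hi => ?_⟩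
    cases i with
    | zero => exact h.2
    | succ i => exact h.1 i (by omega)
  rw [hpre, Measure.prod_prod, Measure.infinitePi_pi _ fun i _ => hum (i + 1),
    Finset.prod_range_succ']

instance : IsProbabilityMeasure uniformAngle :=
  inferInstanceAs (IsProbabilityMeasure (AddCircle.haarAddCircle (T := 2 * Real.pi)))

/-- Write `μ ⊗ λ` as the image of an i.i.d. sequence with an extra angle; `snowflake_eq_step`
identifies `step` of this pair with the snowflake of the prepended sequence. -/
theorem measurePreserving_step (φ : SigmaPrime) {k : ℕ} (hk : 2 ≤ k) {μ : Measure SigmaPrime}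
    (hμ : μ = (Measure.infinitePi fun _ : ℕ => uniformAngle).map (snowflake φ k)) :
    MeasurePreserving (fun p : SigmaPrime × Angles => step φ k p.1 p.2)
      (μ.prod uniformAngle) μ := by
  have hstep := (continuous_step φ (k := k) (by omega)).measurable
  have hS := measurable_snowflake φ hk
  have hcons := measurePreserving_cons uniformAngle
  refine ⟨hstep, ?_⟩
  have h1 : μ.prod uniformAngle =
      ((Measure.infinitePi fun _ : ℕ => uniformAngle).prod uniformAngle).map
        (Prod.map (snowflake φ k) id) := by
    rw [← Measure.map_prod_map _ _ hS measurable_id, Measure.map_id, hμ]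
  rw [h1, Measure.map_map hstep (hS.prodMap measurable_id)]
  conv_rhs => rw [hμ, ← hcons.map_eq, Measure.map_map hS hcons.measurable]
  congr 1
  funext p
  simp only [Function.comp]
  rw [snowflake_eq_step φ hk]
  rfl

end Snowflake

theorem mainTheorem2 (φ : Snowflake.SigmaPrime) (k : ℕ) (hk : 2 ≤ k)
    {Ω : Type*} [MeasurableSpace Ω] (P : Measure Ω) [IsProbabilityMeasure P]
    (θ : ℕ → Ω → Snowflake.Angles)
    (hθ : ∀ n, HasLaw (θ n) Snowflake.uniformAngle P) (hind : iIndepFun θ P)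
    (f : Ω → Snowflake.SigmaPrime)
    (hf : ∀ ω, f ω = Snowflake.snowflake φ k (fun n => θ n ω)) :
    (∀ t : ℕ → Snowflake.Angles,
      Tendsto (Snowflake.approx φ k t) atTop (𝓝 (Snowflake.snowflake φ k t))) ∧
    AEMeasurable f P ∧
    MeasurePreserving (fun p : Snowflake.SigmaPrime × Snowflake.Angles =>
        Snowflake.step φ k p.1 p.2)
      ((P.map f).prod Snowflake.uniformAngle) (P.map f) ∧
    ∀ ϑ : Ω → Snowflake.Angles, HasLaw ϑ Snowflake.uniformAngle P → IndepFun f ϑ P →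
      IdentDistrib f (fun ω => Snowflake.step φ k (f ω) (ϑ ω)) P P ∧
      IdentDistrib (fun ω => (f ω).inv)
        (fun ω => (Snowflake.koebePartial k (f ω).inv).comp
          (Snowflake.rotatePartial (ϑ ω) φ.inv)) P P := by
  have hS := Snowflake.measurable_snowflake φ hk
  have hlaw := hind.hasLaw_infinitePi hθ (aemeasurable_pi_lambda _ fun n => (hθ n).aemeasurable)
  have hfeq : f = Snowflake.snowflake φ k ∘ fun ω n => θ n ω := funext hf
  have hfm : AEMeasurable f P := hfeq ▸ hS.comp_aemeasurable hlaw.aemeasurable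
  have hmap : P.map f =
      (Measure.infinitePi fun _ : ℕ => Snowflake.uniformAngle).map (Snowflake.snowflake φ k) := by
    rw [hfeq, ← AEMeasurable.map_map_of_aemeasurable hS.aemeasurable hlaw.aemeasurable,
      hlaw.map_eq]
  have hstep := Snowflake.measurePreserving_step φ hk hmap
  refine ⟨Snowflake.tendsto_approx φ hk, hfm, hstep, fun ϑ hϑ hfϑ => ?_⟩
  have hpair : P.map (fun ω => (f ω, ϑ ω)) = (P.map f).prod Snowflake.uniformAngle := by
    rw [(indepFun_iff_map_prod_eq_prod_map_map hfm hϑ.aemeasurable).1 hfϑ, hϑ.map_eq]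
  have hpm : AEMeasurable (fun ω => (f ω, ϑ ω)) P := hfm.prodMk hϑ.aemeasurable
  have hstepm : AEMeasurable (fun ω => Snowflake.step φ k (f ω) (ϑ ω)) P := by
    have h := hstep.measurable.comp_aemeasurable hpm
    exact h
  have hlawstep : P.map (fun ω => Snowflake.step φ k (f ω) (ϑ ω)) = P.map f := by
    have h1 := AEMeasurable.map_map_of_aemeasurable hstep.measurable.aemeasurable hpm
    rw [hpair, hstep.map_eq] at h1
    exact h1.symm
  have hid : IdentDistrib f (fun ω => Snowflake.step φ k (f ω) (ϑ ω)) P P :=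
    ⟨hfm, hstepm, hlawstep.symm⟩
  refine ⟨hid, ?_⟩
  have hinv : (fun ω => (Snowflake.koebePartial k (f ω).inv).comp
      (Snowflake.rotatePartial (ϑ ω) φ.inv)) =
      Snowflake.SigmaPrime.inv ∘ fun ω => Snowflake.step φ k (f ω) (ϑ ω) :=
    funext fun ω => (Snowflake.inv_step φ (by omega) (f ω) (ϑ ω)).symm
  rw [hinv]
  exact hid.comp Snowflake.SigmaPrime.measurable_inv
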